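/- Let $F$ be the formal group law over $\mathbb F_2$ of the elliptic curve $y^2+y=x^3$ in the coordinate $z=x/y$ at the point at infinity. Let $\Sigma=K_0E_2$ be the commutative Hopf algebra over $\mathbb F_2$ that corepresents the functor sending a commutative $\mathbb F_2$-algebra $R$ to the group, under composition, of automorphisms of $F$ over $R$, that is, of power series $g(z)=a_1z+a_2z^2+\cdots\in R[[z]]$ with $a_1$ a unit and $g(F(z_0,z_1))=F(g(z_0),g(z_1))$. The coproduct classifies the composite $g_{\mathrm{left}}\circ g_{\mathrm{right}}$ of the two copies over $\Sigma\otimes\Sigma$ of the universal automorphism $g_{\mathrm{univ}}\in\Sigma[[z]]$, the counit classifies the identity, and the antipode classifies the inverse. Then there are elements $t_0,t_1,\dots\in\Sigma$ with $g_{\mathrm{univ}}(z)=\sum^{F}_{i\ge 0}t_iz^{2^i}$ (formal sum with respect to $F$), and they give an isomorphism of algebras $$\Sigma\cong\mathbb F_2[t_0,t_1,t_2,\dots]/(t_0^3-1,\;t_1^4-t_1,\;t_2^4-t_2,\;\dots).$$ The set of grouplike elements of $\Sigma$ is $\{1,t_0,t_0^2\}$. Moreover, $\Sigma$ is pointed,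 i.e. every simple subcoalgebra of $\Sigma$ is one-dimensional, and its coradical filtration is exhaustive: if $R\subset\Sigma$ is the coradical (the sum of the simple subcoalgebras) and $$F_k=\ker\bigl(\Sigma\to\Sigma^{\otimes(k+1)}\to(\Sigma/R)^{\otimes(k+1)}\bigr),$$ where the first map is the iterated coproduct, then $\Sigma=\bigcup_{k\ge0}F_k$. -/

import Mathlib

open scoped TensorProduct PowerSeries

noncomputable section

namespace MoravaHopf

/-! ### Pointed coalgebras and the coradical filtration -/

section Coalg

variable (k : Type*) [Field k] {C : Type*} [AddCommGroup C] [Module k C] [Coalgebra k C]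

/-- A subspace `D` of a coalgebra is a subcoalgebra if `Δ D` lies in (the image of) `D ⊗ D`. -/
def IsSubcoalgebra (D : Submodule k C) : Prop :=
  ∀ x ∈ D, Coalgebra.comul (R := k) x ∈
    LinearMap.range (TensorProduct.map D.subtype D.subtype)

/-- A subcoalgebra is simple if it is nonzero and its only subcoalgebras are `0` and itself. -/
def IsSimpleSubcoalgebra (D : Submodule k C) : Prop :=
  IsSubcoalgebra k D ∧ D ≠ ⊥ ∧
    ∀ D' : Submodule k C, IsSubcoalgebra k D' → D' ≤ D → D' = ⊥ ∨ D' = D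

variable (C)

/-- A coalgebra is pointed if all its simple subcoalgebras are one-dimensional. -/
def IsPointed : Prop :=
  ∀ D : Submodule k C, IsSimpleSubcoalgebra k D → Module.finrank k D = 1

/-- The coradical: the sum of all simple subcoalgebras. -/
def coradical : Submodule k C :=
  sSup {D : Submodule k C | IsSimpleSubcoalgebra k D}

/-- The iterated coproduct `C → C ⊗ ⋯ ⊗ C` (`n + 1` factors). -/
def iteratedComul : (n : ℕ) → C →ₗ[k] TensorPower k (n + 1) C
  | 0 => (PiTensorProduct.subsingletonEquiv (R := k) (s := fun _ : Fin 1 => C) 0).symm.toLinearMap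
  | n + 1 =>
      (TensorPower.mulEquiv (R := k) (M := C) (n := n + 1) (m := 1)).toLinearMap ∘ₗ
        TensorProduct.map (iteratedComul n)
          (PiTensorProduct.subsingletonEquiv (R := k) (s := fun _ : Fin 1 => C) 0).symm.toLinearMap ∘ₗ
        Coalgebra.comul

/-- The `n`-th step `F_n = ker (C → C^{⊗ (n+1)} → (C / R)^{⊗ (n+1)})` of the coradical
filtration, where `R` is the coradical. -/
def coradicalFiltration (n : ℕ) : Submodule k C :=
  LinearMap.ker
    ((PiTensorProduct.map (R := k) (fun _ : Fin (n + 1) => (coradical k C).mkQ)) ∘ₗ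
      iteratedComul k C n)

/-- The coradical filtration is exhaustive: every element lies in some `F_n`. -/
def HasExhaustiveCoradicalFiltration : Prop :=
  ∀ x : C, ∃ n : ℕ, x ∈ coradicalFiltration k C n

end Coalg

/-! ### The formal group of the curve `y² + y = x³` over `𝔽₂`

In the coordinates `z = x / y`, `w = 1 / y` around the point at infinity `O = (0, 0)` the curve is
`w + w² = z³`.  -/

/-- The expansion `w(z) = z³ + z⁶ + z¹² + ⋯` of `w` along the curve, that is, the power series
without constant term solving `w = z³ + w²`. -/
def curveW : (ZMod 2)⟦X⟧ :=
  open Classical in PowerSeries.mk fun n => if ∃ j : ℕ, n = 3 * 2 ^ j then 1 else 0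

/-- The slope `(w(z₁) - w(z₀)) / (z₁ - z₀)` of the chord through `(z₀, w(z₀))` and
`(z₁, w(z₁))`: the coefficient of `z₀^i z₁^j` is the coefficient of `z^(i+j+1)` in `w(z)`. -/
def curveSlope : MvPowerSeries (Fin 2) (ZMod 2) :=
  fun m => PowerSeries.coeff (m 0 + m 1 + 1) curveW

/-- The coordinate `z` of the third point of intersection of the curve with this chord.
Substituting `w = s z + c` in `w + w² = z³` gives `z³ - s² z² - ⋯ = 0`, so that the three roots
add up to `s²`. -/
def curveThird : MvPowerSeries (Fin 2) (ZMod 2) :=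
  MvPowerSeries.X 0 + MvPowerSeries.X 1 + curveSlope ^ 2

/-- The formal group law of the curve in the coordinate `z = x / y`. The sum of two points is the
negative of the third point on their chord; the negative of `(x, y)` is `(x, y + 1)`, whose
coordinate is `x / (y + 1) = z / (1 + w(z))`. -/
def curveFGL : MvPowerSeries (Fin 2) (ZMod 2) :=
  curveThird * (1 + curveW.subst curveThird)⁻¹

/-- The base change of the formal group law to an `𝔽₂`-algebra. -/
def fgl (R : Type*) [CommRing R] [Algebra (ZMod 2) R] : MvPowerSeries (Fin 2) R :=
  MvPowerSeries.map (algebraMap (ZMod 2) R) curveFGL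

/-- `g` is an automorphism over `R` of the formal group: `g(z) = a z + ⋯` with `a` a unit, and
`g(F(z₀, z₁)) = F(g(z₀), g(z₁))`. -/
structure IsFormalAut {R : Type*} [CommRing R] [Algebra (ZMod 2) R] (g : R⟦X⟧) : Prop where
  constantCoeff_eq_zero : PowerSeries.constantCoeff g = 0
  isUnit_coeff_one : IsUnit (PowerSeries.coeff 1 g)
  hom : g.subst (fgl R) =
    (fgl R).subst (fun i : Fin 2 => g.subst (MvPowerSeries.X i : MvPowerSeries (Fin 2) R))

/-- The partial sum `t₀ z +_F t₁ z² +_F ⋯ +_F t_{n-1} z^(2^(n-1))`. -/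
def formalPartialSum {R : Type*} [CommRing R] [Algebra (ZMod 2) R] (t : ℕ → R) : ℕ → R⟦X⟧
  | 0 => 0
  | n + 1 => (fgl R).subst
      ![formalPartialSum t n, PowerSeries.C (t n) * (PowerSeries.X : R⟦X⟧) ^ (2 ^ n)]

/-- `g` is the infinite formal sum `∑^F t_i z^(2^i)`, the limit of the partial sums. -/
def IsFormalSum {R : Type*} [CommRing R] [Algebra (ZMod 2) R] (t : ℕ → R) (g : R⟦X⟧) : Prop :=
  ∀ n : ℕ, (PowerSeries.X : R⟦X⟧) ^ (2 ^ n) ∣ g - formalPartialSum t n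

/-! ### The group structure on automorphisms -/

lemma constantCoeff_curveThird : MvPowerSeries.constantCoeff curveThird = 0 := by
  have h : MvPowerSeries.constantCoeff curveSlope = 0 := by
    rw [← MvPowerSeries.coeff_zero_eq_constantCoeff_apply]
    change PowerSeries.coeff 1 curveW = 0
    rw [curveW, PowerSeries.coeff_mk, if_neg]
    rintro ⟨j, hj⟩
    omega
  simp [curveThird, h]

lemma constantCoeff_fgl (R : Type*) [CommRing R] [Algebra (ZMod 2) R] :
    MvPowerSeries.constantCoeff (fgl R) = 0 := by
  simp [fgl, curveFGL, constantCoeff_curveThird]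

lemma map_fgl {R S : Type*} [CommRing R] [Algebra (ZMod 2) R] [CommRing S] [Algebra (ZMod 2) S]
    (φ : R →ₐ[ZMod 2] S) : MvPowerSeries.map (φ : R →+* S) (fgl R) = fgl S := by
  ext m
  simp [fgl]

section Series

variable {R : Type*} [CommRing R] {g h : R⟦X⟧}

lemma hasSubst_of_zero (hh : PowerSeries.constantCoeff h = 0) : PowerSeries.HasSubst h :=
  PowerSeries.HasSubst.of_constantCoeff_zero' hh

lemma constantCoeff_comp (hg : PowerSeries.constantCoeff g = 0)
    (hh : PowerSeries.constantCoeff h = 0) :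
    PowerSeries.constantCoeff (g.subst h) = 0 :=
  PowerSeries.constantCoeff_subst_eq_zero hh g hg

lemma coeff_one_comp (hh : PowerSeries.constantCoeff h = 0) :
    PowerSeries.coeff 1 (g.subst h) = PowerSeries.coeff 1 g * PowerSeries.coeff 1 h := by
  rw [PowerSeries.coeff_subst' (hasSubst_of_zero hh), finsum_eq_single _ 1]
  · simp
  · intro n hn
    obtain ⟨q, rfl⟩ := PowerSeries.X_dvd_iff.mpr hh
    rcases n with _ | _ | n
    · simp [PowerSeries.coeff_one]
    · exact absurd rfl hn
    · rw [mul_pow, PowerSeries.coeff_X_pow_mul', if_neg (by omega), smul_zero]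

lemma comp_assoc {τ : Type*} {u : MvPowerSeries τ R}
    (hh : PowerSeries.constantCoeff h = 0) (hu : MvPowerSeries.constantCoeff u = 0) :
    PowerSeries.subst u (g.subst h) = g.subst (h.subst u) :=
  PowerSeries.subst_comp_subst_apply (hasSubst_of_zero hh)
    (PowerSeries.HasSubst.of_constantCoeff_zero hu) g

lemma constantCoeff_subst_X (hg : PowerSeries.constantCoeff g = 0) (i : Fin 2) :
    MvPowerSeries.constantCoeff
      (g.subst (MvPowerSeries.X i : MvPowerSeries (Fin 2) R)) = 0 :=
  PowerSeries.constantCoeff_subst_eq_zero (by simp) g hg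

lemma hasSubst_pair (hg : PowerSeries.constantCoeff g = 0) :
    MvPowerSeries.HasSubst
      (fun i : Fin 2 => g.subst (MvPowerSeries.X i : MvPowerSeries (Fin 2) R)) :=
  MvPowerSeries.hasSubst_of_constantCoeff_zero (constantCoeff_subst_X hg)

/-- Substituting `(h(z₀), h(z₁))` in `g(z_i)` gives `(g ∘ h)(z_i)`. -/
lemma subst_pair_subst_X (hh : PowerSeries.constantCoeff h = 0) (i : Fin 2) :
    (g.subst (MvPowerSeries.X i : MvPowerSeries (Fin 2) R)).subst
      (fun i : Fin 2 => h.subst (MvPowerSeries.X i : MvPowerSeries (Fin 2) R)) =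
    PowerSeries.subst (MvPowerSeries.X i : MvPowerSeries (Fin 2) R) (g.subst h) := by
  rw [comp_assoc hh (by simp), PowerSeries.subst,
    MvPowerSeries.subst_comp_subst_apply (PowerSeries.HasSubst.X i).const (hasSubst_pair hh)]
  simp_rw [MvPowerSeries.subst_X (hasSubst_pair hh)]
  rfl

end Series

section Aut

variable {R : Type*} [CommRing R] [Algebra (ZMod 2) R] {g h : R⟦X⟧}

lemma isFormalAut_X : IsFormalAut (PowerSeries.X : R⟦X⟧) where
  constantCoeff_eq_zero := by simp
  isUnit_coeff_one := by simp
  hom := by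
    simp_rw [PowerSeries.subst_X (PowerSeries.HasSubst.X _)]
    rw [PowerSeries.subst_X (PowerSeries.HasSubst.of_constantCoeff_zero (constantCoeff_fgl R))]
    exact (congrFun MvPowerSeries.subst_self (fgl R)).symm

lemma IsFormalAut.comp (hg : IsFormalAut g) (hh : IsFormalAut h) : IsFormalAut (g.subst h) where
  constantCoeff_eq_zero := constantCoeff_comp hg.1 hh.1
  isUnit_coeff_one := by
    rw [coeff_one_comp hh.1]
    exact hg.2.mul hh.2
  hom := by
    have key : (g.subst (fgl R)).subst
        (fun i : Fin 2 => h.subst (MvPowerSeries.X i : MvPowerSeries (Fin 2) R)) =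
        g.subst ((fgl R).subst
          (fun i : Fin 2 => h.subst (MvPowerSeries.X i : MvPowerSeries (Fin 2) R))) := by
      rw [PowerSeries.subst, MvPowerSeries.subst_comp_subst_apply
        (PowerSeries.HasSubst.of_constantCoeff_zero (constantCoeff_fgl R)).const
        (hasSubst_pair hh.1)]
      rfl
    rw [comp_assoc hh.1 (constantCoeff_fgl R), hh.hom, ← key, hg.hom,
      MvPowerSeries.subst_comp_subst_apply (hasSubst_pair hg.1) (hasSubst_pair hh.1)]
    simp_rw [subst_pair_subst_X hh.1]

lemma IsFormalAut.map {S : Type*} [CommRing S] [Algebra (ZMod 2) S] (hg : IsFormalAut g)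
    (φ : R →ₐ[ZMod 2] S) : IsFormalAut (PowerSeries.map (φ : R →+* S) g) where
  constantCoeff_eq_zero := by
    rw [← PowerSeries.coeff_zero_eq_constantCoeff_apply, PowerSeries.coeff_map,
      PowerSeries.coeff_zero_eq_constantCoeff_apply, hg.1, map_zero]
  isUnit_coeff_one := by
    rw [PowerSeries.coeff_map]
    exact hg.2.map _
  hom := by
    have h1 := congrArg (MvPowerSeries.map (φ : R →+* S)) hg.hom
    rw [PowerSeries.map_subst (PowerSeries.HasSubst.of_constantCoeff_zero (constantCoeff_fgl R)),
      MvPowerSeries.map_subst (hasSubst_pair hg.1), map_fgl] at h1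
    simp_rw [PowerSeries.map_subst (PowerSeries.HasSubst.X _), MvPowerSeries.map_X] at h1
    exact h1

/-- The compositional inverse of an automorphism. -/
def IsFormalAut.inv (hg : IsFormalAut g) : R⟦X⟧ := g.substInvOfIsUnit hg.2

lemma IsFormalAut.constantCoeff_inv (hg : IsFormalAut g) :
    PowerSeries.constantCoeff hg.inv = 0 :=
  PowerSeries.constantCoeff_substInvOfIsUnit g hg.2

lemma IsFormalAut.comp_inv (hg : IsFormalAut g) : g.subst hg.inv = PowerSeries.X :=
  PowerSeries.subst_substInvOfIsUnit_right g hg.1 hg.2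

lemma IsFormalAut.inv_comp (hg : IsFormalAut g) : hg.inv.subst g = PowerSeries.X :=
  PowerSeries.subst_substInvOfIsUnit_left g hg.1 hg.2

lemma IsFormalAut.isFormalAut_inv (hg : IsFormalAut g) : IsFormalAut hg.inv where
  constantCoeff_eq_zero := hg.constantCoeff_inv
  isUnit_coeff_one := by
    rw [IsFormalAut.inv, PowerSeries.coeff_one_substInvOfIsUnit]
    exact Units.isUnit _
  hom := by
    have hu := hasSubst_pair hg.constantCoeff_inv
    have hF : MvPowerSeries.constantCoeff ((fgl R).subst
        (fun i : Fin 2 => hg.inv.subst (MvPowerSeries.X i : MvPowerSeries (Fin 2) R))) = 0 :=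
      MvPowerSeries.constantCoeff_subst_eq_zero hu (constantCoeff_subst_X hg.constantCoeff_inv)
        (constantCoeff_fgl R)
    have h1 : (fgl R) = g.subst ((fgl R).subst
        (fun i : Fin 2 => hg.inv.subst (MvPowerSeries.X i : MvPowerSeries (Fin 2) R))) := by
      have h2 := congrArg (MvPowerSeries.subst
        (fun i : Fin 2 => hg.inv.subst (MvPowerSeries.X i : MvPowerSeries (Fin 2) R))) hg.hom
      rw [MvPowerSeries.subst_comp_subst_apply (hasSubst_pair hg.1) hu] at h2
      simp_rw [subst_pair_subst_X hg.constantCoeff_inv, hg.comp_inv] at h2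
      simp_rw [PowerSeries.subst_X (PowerSeries.HasSubst.X _)] at h2
      rw [PowerSeries.subst, MvPowerSeries.subst_comp_subst_apply
        (PowerSeries.HasSubst.of_constantCoeff_zero (constantCoeff_fgl R)).const hu] at h2
      exact (h2.trans (congrFun MvPowerSeries.subst_self (fgl R))).symm
    conv_lhs => rw [h1]
    rw [← comp_assoc hg.1 hF, hg.inv_comp,
      PowerSeries.subst_X (PowerSeries.HasSubst.of_constantCoeff_zero hF)]

end Aut

/-! ### The Hopf algebra `Σ` -/

/-- Polynomials in `a₁, a₂, …` (`a_{n+1}` is the variable `some n`) and `b` (the variable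
`none`, which is to become the inverse of `a₁`). -/
abbrev CoeffPoly : Type := MvPolynomial (Option ℕ) (ZMod 2)

/-- The power series `a₁ z + a₂ z² + ⋯`. -/
def genericSeries : CoeffPoly⟦X⟧ :=
  PowerSeries.mk fun n => n.casesOn 0 fun i => MvPolynomial.X (some i)

/-- The relations saying that `a₁ z + a₂ z² + ⋯` is an automorphism of the formal group: `a₁` is
a unit, and both sides of `g(F(z₀, z₁)) = F(g(z₀), g(z₁))` have the same coefficients. -/
def relations : Ideal CoeffPoly :=
  Ideal.span ({MvPolynomial.X (some 0) * MvPolynomial.X none - 1} ∪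
    Set.range fun m : Fin 2 →₀ ℕ => MvPowerSeries.coeff m
      (genericSeries.subst (fgl CoeffPoly) - (fgl CoeffPoly).subst (fun i : Fin 2 =>
        genericSeries.subst (MvPowerSeries.X i : MvPowerSeries (Fin 2) CoeffPoly))))

/-- The ring `Σ` which corepresents the functor sending an `𝔽₂`-algebra `R` to the group of
automorphisms over `R` of the formal group of `y² + y = x³`. -/
def SigmaAlg : Type := CoeffPoly ⧸ relations

instance : CommRing SigmaAlg := inferInstanceAs (CommRing (CoeffPoly ⧸ relations))

instance : Algebra (ZMod 2) SigmaAlg :=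
  inferInstanceAs (Algebra (ZMod 2) (CoeffPoly ⧸ relations))

/-- The quotient map. -/
def toSigma : CoeffPoly →ₐ[ZMod 2] SigmaAlg := Ideal.Quotient.mkₐ (ZMod 2) relations

/-- The universal automorphism of the formal group, with coefficients in `Σ`. -/
def universalAut : SigmaAlg⟦X⟧ := PowerSeries.map (toSigma : CoeffPoly →+* SigmaAlg) genericSeries

lemma constantCoeff_genericSeries : PowerSeries.constantCoeff genericSeries = 0 := by
  rw [← PowerSeries.coeff_zero_eq_constantCoeff_apply, genericSeries, PowerSeries.coeff_mk]
  rfl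

lemma coeff_universalAut (n : ℕ) :
    PowerSeries.coeff (n + 1) universalAut = toSigma (MvPolynomial.X (some n)) := by
  rw [universalAut, PowerSeries.coeff_map, genericSeries, PowerSeries.coeff_mk]
  rfl

lemma toSigma_eq_zero {p : CoeffPoly} (hp : p ∈ relations) : toSigma p = 0 :=
  Ideal.Quotient.eq_zero_iff_mem.mpr hp

lemma toSigma_unit : toSigma (MvPolynomial.X (some 0)) * toSigma (MvPolynomial.X none) = 1 := by
  have h := toSigma_eq_zero (Ideal.subset_span (Or.inl rfl) : MvPolynomial.X (some 0) *
    MvPolynomial.X none - 1 ∈ relations)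
  rwa [map_sub, map_mul, map_one, sub_eq_zero] at h

lemma isFormalAut_universalAut : IsFormalAut universalAut where
  constantCoeff_eq_zero := by
    rw [← PowerSeries.coeff_zero_eq_constantCoeff_apply, universalAut, PowerSeries.coeff_map,
      PowerSeries.coeff_zero_eq_constantCoeff_apply, constantCoeff_genericSeries, map_zero]
  isUnit_coeff_one := by
    rw [coeff_universalAut 0]
    exact IsUnit.of_mul_eq_one _ toSigma_unit
  hom := by
    have h1 : MvPowerSeries.map (toSigma : CoeffPoly →+* SigmaAlg)
        (genericSeries.subst (fgl CoeffPoly) - (fgl CoeffPoly).subst (fun i : Fin 2 =>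
          genericSeries.subst (MvPowerSeries.X i : MvPowerSeries (Fin 2) CoeffPoly))) = 0 := by
      ext m
      rw [MvPowerSeries.coeff_map]
      exact toSigma_eq_zero (Ideal.subset_span (Or.inr ⟨m, rfl⟩))
    rw [map_sub, sub_eq_zero, PowerSeries.map_subst
        (PowerSeries.HasSubst.of_constantCoeff_zero (constantCoeff_fgl _)),
      MvPowerSeries.map_subst (hasSubst_pair constantCoeff_genericSeries), map_fgl] at h1
    simp_rw [PowerSeries.map_subst (PowerSeries.HasSubst.X _), MvPowerSeries.map_X] at h1
    exact h1

section Lift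

variable {R : Type*} [CommRing R] [Algebra (ZMod 2) R]

/-- The algebra map `Σ → R` classifying an automorphism over `R`. -/
def classify (g : R⟦X⟧) (hg : IsFormalAut g) : SigmaAlg →ₐ[ZMod 2] R :=
  Ideal.Quotient.liftₐ relations
    (MvPolynomial.aeval fun o : Option ℕ =>
      o.elim ((hg.isUnit_coeff_one.unit⁻¹ : Rˣ) : R) fun n => PowerSeries.coeff (n + 1) g)
    (by
      set φ : CoeffPoly →ₐ[ZMod 2] R := MvPolynomial.aeval fun o : Option ℕ =>
        o.elim ((hg.isUnit_coeff_one.unit⁻¹ : Rˣ) : R)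
          fun n => PowerSeries.coeff (n + 1) g with hφ
      have hmap : PowerSeries.map (φ : CoeffPoly →+* R) genericSeries = g := by
        ext n
        rw [PowerSeries.coeff_map, genericSeries, PowerSeries.coeff_mk]
        cases n with
        | zero =>
          rw [PowerSeries.coeff_zero_eq_constantCoeff_apply, hg.1]
          exact map_zero _
        | succ n => simp [hφ]
      suffices h : relations ≤ RingHom.ker (φ : CoeffPoly →+* R) from fun a ha => h ha
      refine Ideal.span_le.mpr ?_
      rintro p (rfl | ⟨m, rfl⟩)
      · simp [hφ, RingHom.mem_ker]
      · change (φ : CoeffPoly →+* R) _ = 0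
        rw [← MvPowerSeries.coeff_map, map_sub, PowerSeries.map_subst
            (PowerSeries.HasSubst.of_constantCoeff_zero (constantCoeff_fgl _)),
          MvPowerSeries.map_subst (hasSubst_pair constantCoeff_genericSeries), map_fgl]
        simp_rw [PowerSeries.map_subst (PowerSeries.HasSubst.X _), MvPowerSeries.map_X]
        erw [hmap]
        rw [hg.hom, sub_self, map_zero])

lemma map_classify (g : R⟦X⟧) (hg : IsFormalAut g) :
    PowerSeries.map (classify g hg : SigmaAlg →+* R) universalAut = g := by
  ext n
  rw [PowerSeries.coeff_map]
  cases n with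
  | zero =>
    rw [PowerSeries.coeff_zero_eq_constantCoeff_apply, isFormalAut_universalAut.1,
      PowerSeries.coeff_zero_eq_constantCoeff_apply, hg.1, map_zero]
  | succ n =>
    rw [coeff_universalAut]
    change MvPolynomial.aeval _ (MvPolynomial.X (some n)) = _
    simp

/-- An algebra map out of `Σ` is determined by the automorphism that it classifies. -/
lemma hom_ext {φ ψ : SigmaAlg →ₐ[ZMod 2] R}
    (h : PowerSeries.map (φ : SigmaAlg →+* R) universalAut =
      PowerSeries.map (ψ : SigmaAlg →+* R) universalAut) : φ = ψ := by
  have h1 : ∀ n, φ (toSigma (MvPolynomial.X (some n))) =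
      ψ (toSigma (MvPolynomial.X (some n))) := by
    intro n
    have := congrArg (PowerSeries.coeff (n + 1)) h
    rw [PowerSeries.coeff_map, PowerSeries.coeff_map, coeff_universalAut] at this
    exact this
  have h2 : φ (toSigma (MvPolynomial.X none)) = ψ (toSigma (MvPolynomial.X none)) := by
    have e1 := congrArg φ toSigma_unit
    have e2 := congrArg ψ toSigma_unit
    rw [map_mul, map_one] at e1 e2
    rw [← h1 0] at e2
    rw [mul_comm] at e1
    exact left_inv_eq_right_inv e1 e2
  have h3 : φ.comp toSigma = ψ.comp toSigma := by
    apply MvPolynomial.algHom_ext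
    rintro (_ | n)
    · exact h2
    · exact h1 n
  ext x
  obtain ⟨p, rfl⟩ := Ideal.Quotient.mk_surjective x
  exact DFunLike.congr_fun h3 p

end Lift

/-- The universal automorphism with coefficients in the left factor of `Σ ⊗ Σ`. -/
def leftAut : (SigmaAlg ⊗[ZMod 2] SigmaAlg)⟦X⟧ :=
  PowerSeries.map ((Algebra.TensorProduct.includeLeft : SigmaAlg →ₐ[ZMod 2]
    SigmaAlg ⊗[ZMod 2] SigmaAlg) : SigmaAlg →+* SigmaAlg ⊗[ZMod 2] SigmaAlg) universalAut

/-- The universal automorphism with coefficients in the right factor of `Σ ⊗ Σ`. -/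
def rightAut : (SigmaAlg ⊗[ZMod 2] SigmaAlg)⟦X⟧ :=
  PowerSeries.map ((Algebra.TensorProduct.includeRight : SigmaAlg →ₐ[ZMod 2]
    SigmaAlg ⊗[ZMod 2] SigmaAlg) : SigmaAlg →+* SigmaAlg ⊗[ZMod 2] SigmaAlg) universalAut

lemma isFormalAut_leftAut : IsFormalAut leftAut := isFormalAut_universalAut.map _

lemma isFormalAut_rightAut : IsFormalAut rightAut := isFormalAut_universalAut.map _

/-- The coproduct of `Σ`, classifying the composite `left ∘ right`. -/
def sigmaComul : SigmaAlg →ₐ[ZMod 2] SigmaAlg ⊗[ZMod 2] SigmaAlg :=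
  classify (leftAut.subst rightAut) (isFormalAut_leftAut.comp isFormalAut_rightAut)

/-- The counit of `Σ`, classifying the identity automorphism. -/
def sigmaCounit : SigmaAlg →ₐ[ZMod 2] ZMod 2 := classify PowerSeries.X isFormalAut_X

/-- The antipode of `Σ`, classifying the inverse of the universal automorphism. -/
def sigmaAntipode : SigmaAlg →ₐ[ZMod 2] SigmaAlg :=
  classify isFormalAut_universalAut.inv isFormalAut_universalAut.isFormalAut_inv

section Axioms

variable {R : Type*} [CommRing R] [Algebra (ZMod 2) R]

/-- The automorphism classified by `φ : Σ → R`. -/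
def autOf (φ : SigmaAlg →ₐ[ZMod 2] R) : R⟦X⟧ :=
  PowerSeries.map (φ : SigmaAlg →+* R) universalAut

lemma isFormalAut_autOf (φ : SigmaAlg →ₐ[ZMod 2] R) : IsFormalAut (autOf φ) :=
  isFormalAut_universalAut.map φ

lemma autOf_comp {S : Type*} [CommRing S] [Algebra (ZMod 2) S] (ψ : R →ₐ[ZMod 2] S)
    (φ : SigmaAlg →ₐ[ZMod 2] R) :
    autOf (ψ.comp φ) = PowerSeries.map (ψ : R →+* S) (autOf φ) := by
  ext n
  simp [autOf]

lemma autOf_comul (ψ : SigmaAlg ⊗[ZMod 2] SigmaAlg →ₐ[ZMod 2] R) :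
    autOf (ψ.comp sigmaComul) =
      (autOf (ψ.comp Algebra.TensorProduct.includeLeft)).subst
        (autOf (ψ.comp Algebra.TensorProduct.includeRight)) := by
  rw [autOf_comp, autOf_comp, autOf_comp]
  have h : autOf sigmaComul = leftAut.subst rightAut := map_classify _ _
  rw [h]
  exact PowerSeries.map_subst (hasSubst_of_zero isFormalAut_rightAut.1) _

lemma autOf_counit (ψ : ZMod 2 →ₐ[ZMod 2] R) :
    autOf (ψ.comp sigmaCounit) = PowerSeries.X := by
  have h : autOf sigmaCounit = PowerSeries.X := map_classify _ _
  rw [autOf_comp, h, PowerSeries.map_X]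

lemma autOf_id : autOf (AlgHom.id (ZMod 2) SigmaAlg) = universalAut := by
  ext n
  simp [autOf]

end Axioms

lemma comul_coassoc :
    (Algebra.TensorProduct.assoc (ZMod 2) (ZMod 2) (ZMod 2) SigmaAlg SigmaAlg
        SigmaAlg).toAlgHom.comp
      ((Algebra.TensorProduct.map sigmaComul (.id (ZMod 2) SigmaAlg)).comp sigmaComul) =
    (Algebra.TensorProduct.map (.id (ZMod 2) SigmaAlg) sigmaComul).comp sigmaComul := by
  apply hom_ext
  change autOf _ = autOf _
  set as := (Algebra.TensorProduct.assoc (ZMod 2) (ZMod 2) (ZMod 2) SigmaAlg SigmaAlg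
        SigmaAlg).toAlgHom with has
  have e1 : (as.comp (Algebra.TensorProduct.map sigmaComul (.id (ZMod 2) SigmaAlg))).comp
      Algebra.TensorProduct.includeLeft =
      (as.comp Algebra.TensorProduct.includeLeft).comp sigmaComul := by
    ext x; simp
  have e2 : (as.comp (Algebra.TensorProduct.map sigmaComul (.id (ZMod 2) SigmaAlg))).comp
      Algebra.TensorProduct.includeRight =
      Algebra.TensorProduct.includeRight.comp Algebra.TensorProduct.includeRight := by
    ext x; simp [has, Algebra.TensorProduct.one_def]
  have e3 : (as.comp Algebra.TensorProduct.includeLeft).comp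
      Algebra.TensorProduct.includeLeft = Algebra.TensorProduct.includeLeft := by
    ext x; simp [has, Algebra.TensorProduct.one_def]
  have e4 : (as.comp Algebra.TensorProduct.includeLeft).comp
      Algebra.TensorProduct.includeRight =
      Algebra.TensorProduct.includeRight.comp Algebra.TensorProduct.includeLeft := by
    ext x; simp [has]
  have e5 : (Algebra.TensorProduct.map (.id (ZMod 2) SigmaAlg) sigmaComul).comp
      Algebra.TensorProduct.includeLeft = Algebra.TensorProduct.includeLeft := by
    ext x; simp
  have e6 : (Algebra.TensorProduct.map (.id (ZMod 2) SigmaAlg) sigmaComul).comp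
      Algebra.TensorProduct.includeRight =
      Algebra.TensorProduct.includeRight.comp sigmaComul := by
    ext x; simp
  rw [← AlgHom.comp_assoc, autOf_comul, autOf_comul, e1, e2, e5, e6, autOf_comul, autOf_comul,
    e3, e4]
  exact comp_assoc (isFormalAut_autOf _).1 (isFormalAut_autOf _).1

lemma counit_comul :
    (Algebra.TensorProduct.map sigmaCounit (.id (ZMod 2) SigmaAlg)).comp sigmaComul =
      (Algebra.TensorProduct.lid (ZMod 2) SigmaAlg).symm := by
  apply hom_ext
  change autOf _ = autOf _
  have e1 : (Algebra.TensorProduct.map sigmaCounit (.id (ZMod 2) SigmaAlg)).comp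
      Algebra.TensorProduct.includeLeft =
      Algebra.TensorProduct.includeLeft.comp sigmaCounit := by
    ext x; simp
  have e2 : (Algebra.TensorProduct.map sigmaCounit (.id (ZMod 2) SigmaAlg)).comp
      Algebra.TensorProduct.includeRight =
      ((Algebra.TensorProduct.lid (ZMod 2) SigmaAlg).symm : SigmaAlg →ₐ[ZMod 2] _) := by
    ext x; simp
  rw [autOf_comul, e1, e2, autOf_counit,
    PowerSeries.subst_X (hasSubst_of_zero (isFormalAut_autOf _).1)]

lemma comul_counit :
    (Algebra.TensorProduct.map (.id (ZMod 2) SigmaAlg) sigmaCounit).comp sigmaComul =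
      (Algebra.TensorProduct.rid (ZMod 2) (ZMod 2) SigmaAlg).symm := by
  apply hom_ext
  change autOf _ = autOf _
  have e1 : (Algebra.TensorProduct.map (.id (ZMod 2) SigmaAlg) sigmaCounit).comp
      Algebra.TensorProduct.includeRight =
      Algebra.TensorProduct.includeRight.comp sigmaCounit := by
    ext x; simp
  have e2 : (Algebra.TensorProduct.map (.id (ZMod 2) SigmaAlg) sigmaCounit).comp
      Algebra.TensorProduct.includeLeft =
      ((Algebra.TensorProduct.rid (ZMod 2) (ZMod 2) SigmaAlg).symm : SigmaAlg →ₐ[ZMod 2] _) := by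
    ext x; simp
  rw [autOf_comul, e1, e2, autOf_counit]
  exact (PowerSeries.map_algebraMap_eq_subst_X _).symm

instance : Bialgebra (ZMod 2) SigmaAlg :=
  Bialgebra.ofAlgHom sigmaComul sigmaCounit comul_coassoc counit_comul comul_counit

lemma autOf_antipode : autOf sigmaAntipode = isFormalAut_universalAut.inv := map_classify _ _

lemma antipode_comul :
    (Algebra.TensorProduct.lift sigmaAntipode (.id (ZMod 2) SigmaAlg)
      fun _ ↦ Commute.all _).comp sigmaComul =
    (Algebra.ofId (ZMod 2) SigmaAlg).comp sigmaCounit := by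
  apply hom_ext
  change autOf _ = autOf _
  set ψ := Algebra.TensorProduct.lift sigmaAntipode (AlgHom.id (ZMod 2) SigmaAlg)
    (fun _ _ ↦ Commute.all _ _) with hψ
  have e1 : ψ.comp Algebra.TensorProduct.includeLeft = sigmaAntipode := by
    ext x; simp [hψ]
  have e2 : ψ.comp Algebra.TensorProduct.includeRight = AlgHom.id (ZMod 2) SigmaAlg := by
    ext x; simp [hψ]
  rw [autOf_comul, autOf_counit, e1, e2, autOf_antipode, autOf_id]
  exact isFormalAut_universalAut.inv_comp

lemma comul_antipode :
    (Algebra.TensorProduct.lift (.id (ZMod 2) SigmaAlg) sigmaAntipode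
      fun _ _ ↦ Commute.all _ _).comp sigmaComul =
    (Algebra.ofId (ZMod 2) SigmaAlg).comp sigmaCounit := by
  apply hom_ext
  change autOf _ = autOf _
  set ψ := Algebra.TensorProduct.lift (AlgHom.id (ZMod 2) SigmaAlg) sigmaAntipode
    (fun _ _ ↦ Commute.all _ _) with hψ
  have e1 : ψ.comp Algebra.TensorProduct.includeLeft = AlgHom.id (ZMod 2) SigmaAlg := by
    ext x; simp [hψ]
  have e2 : ψ.comp Algebra.TensorProduct.includeRight = sigmaAntipode := by
    ext x; simp [hψ]
  rw [autOf_comul, autOf_counit, e1, e2, autOf_antipode, autOf_id]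
  exact isFormalAut_universalAut.comp_inv

/-- The Hopf algebra structure of `Σ`, given by the composition of automorphisms. -/
instance : HopfAlgebra (ZMod 2) SigmaAlg :=
  HopfAlgebra.ofAlgHom sigmaAntipode antipode_comul comul_antipode

/-- The presentation `𝔽₂[t₀, t₁, …] / (t₀³ - 1, t₁⁴ - t₁, t₂⁴ - t₂, …)`. -/
abbrev SigmaPresentation : Type :=
  MvPolynomial ℕ (ZMod 2) ⧸ Ideal.span
    ({MvPolynomial.X 0 ^ 3 - 1} ∪
      Set.range fun i : ℕ =>
        (MvPolynomial.X (i + 1) ^ 4 - MvPolynomial.X (i + 1) : MvPolynomial ℕ (ZMod 2)))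

/-- The class of `t_i`. -/
def tGen (i : ℕ) : SigmaPresentation := Ideal.Quotient.mk _ (MvPolynomial.X i)

end MoravaHopf

end

open MoravaHopf

/-!
Write `F` for the formal group law. The proof has three parts.

*The formal group.* A power series `u` without constant term gives the point `(u, w(u))` of the
curve `w + w² = z³`. The series `w(u)` is the only solution without constant term of this equation
(`eq_wAt`), and the slope `s` of the chord through the points at `u` and `v` is the only solution
without constant term of a quadratic equation (`slope_quadratic`, `eq_slopeAt`). These two
uniqueness statements reduce all identities for `F` to polynomial algebra in characteristic `2`:
commutativity, doubling `F(u, u) = -u⁴`, compatibility with Frobenius and with scaling by solutions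
of `c⁴ = c`. Only associativity is taken from the group law of the elliptic curve `y² + y = x³` over
the field of fractions of `𝔽₂⟦z₀, z₁, z₂⟧`, where the generic points are added by the chord
construction (`fadd_assoc_X`). As `F` has coefficients in `𝔽₂`, all of this holds over every
`𝔽₂`-algebra.

*The presentation.* An endomorphism `g` of `F` commutes with `[-2](z) = z⁴`, so its leading
coefficient satisfies `t⁴ = t`, and then `t z` is an endomorphism as well. The difference
`g - t z` (with respect to `F`) has vanishing derivative at `0`, hence everywhere because it is a
homomorphism, and therefore factors through Frobenius: it is `g'(z²)` for an endomorphism `g'`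
(`IsFormalEnd.exists_eq_comp_sq`). Iterating this gives `g = ∑ t_i z^(2^i)` with `t_i⁴ = t_i`, and
conversely all finite sums of this kind are endomorphisms. So `Σ` is generated by the `t_i` of the
universal automorphism. An element of the presentation involves only finitely many generators, so
that no relations can hold beyond the given ones: they would be visible on a finite sum over the
presentation itself (`injective_of_isFormalSum`).

*The coalgebra.* Give the coefficient `a_(n+1)` of `z^(n+1)` in the universal automorphism the
degree `n`. By the formula for composition, `Δ a_n = ∑_d a_d ⊗ [z^n] g(z)^d`, the monomials of degree
at most `n` span an exhaustive coalgebra filtration (`degreeFiltration`). Its degree zero part is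
spanned by the grouplike elements `1, a₁, a₁²`, because `a₁³ = 1`. A functional that
vanishes in degree zero lowers the degree when it acts on the coalgebra, so every nonzero
subcoalgebra meets the degree zero part (`IsPointedFiltration.exists_mem_zero`). Hence the simple
subcoalgebras are the lines through grouplike elements. Moreover, the filtration is finer than the
coradical filtration, which is therefore exhaustive.
-/

noncomputable section

namespace MoravaHopf

/-! ### Divided differences of power series -/

section DiffQuot

variable {R : Type*} [CommRing R] {τ : Type*}

/-- The divided difference `(a(z₁) - a(z₀)) / (z₁ - z₀)` of a power series in one variable. -/
def diffQuot (a : R⟦X⟧) : MvPowerSeries (Fin 2) R :=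
  fun m => PowerSeries.coeff (m 0 + m 1 + 1) a

lemma coeff_X_mul (s : τ) (f : MvPowerSeries τ R) (m : τ →₀ ℕ) :
    MvPowerSeries.coeff m (MvPowerSeries.X s * f) =
      if m s = 0 then 0 else MvPowerSeries.coeff (m - Finsupp.single s 1) f := by
  classical
  rw [MvPowerSeries.X_def, MvPowerSeries.coeff_monomial_mul, one_mul]
  simp only [Finsupp.single_le_iff, Nat.one_le_iff_ne_zero, ite_not]

lemma X_sub_X_mul_diffQuot (a : R⟦X⟧) :
    (MvPowerSeries.X 1 - MvPowerSeries.X 0) * diffQuot a =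
      a.subst (MvPowerSeries.X 1 : MvPowerSeries (Fin 2) R) -
        a.subst (MvPowerSeries.X 0 : MvPowerSeries (Fin 2) R) := by
  ext m
  rw [sub_mul, map_sub, map_sub, coeff_X_mul, coeff_X_mul, PowerSeries.coeff_subst_single,
    PowerSeries.coeff_subst_single]
  have e (n : Fin 2 →₀ ℕ) : MvPowerSeries.coeff n (diffQuot a) =
      PowerSeries.coeff (n 0 + n 1 + 1) a := rfl
  have h1 : m = Finsupp.single 1 (m 1) ↔ m 0 = 0 := by
    simp [Finsupp.ext_iff, Fin.forall_fin_two]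
  have h0 : m = Finsupp.single 0 (m 0) ↔ m 1 = 0 := by
    simp [Finsupp.ext_iff, Fin.forall_fin_two]
  rw [e, e]
  simp only [h0, h1]
  by_cases c0 : m 0 = 0 <;> by_cases c1 : m 1 = 0
  · simp [c0, c1]
  · simp [c0, c1, Nat.sub_add_cancel (Nat.pos_of_ne_zero c1)]
  · simp [c0, c1, Nat.sub_add_cancel (Nat.pos_of_ne_zero c0)]
  · simp only [c0, c1, if_false, sub_zero]
    rw [sub_eq_zero]
    congr 2
    simp
    omega

end DiffQuot

section Subst

variable {R : Type*} [CommRing R] {τ υ : Type*}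

lemma two_eq_zero (A : Type*) [CommRing A] [Algebra (ZMod 2) A] : (2 : A) = 0 := by
  have h := congrArg (algebraMap (ZMod 2) A) (show (2 : ZMod 2) = 0 from rfl)
  rwa [map_ofNat, map_zero] at h

lemma hasSubst_vec {S : Type*} [CommRing S] {u v : MvPowerSeries τ S}
    (hu : MvPowerSeries.constantCoeff u = 0)
    (hv : MvPowerSeries.constantCoeff v = 0) : MvPowerSeries.HasSubst ![u, v] :=
  MvPowerSeries.hasSubst_of_constantCoeff_zero fun i => by fin_cases i <;> simp [hu, hv]

lemma subst_vec_comp {A S T : Type*} [CommRing A] [CommRing S] [CommRing T] [Algebra A S]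
    [Algebra A T] [Algebra S T] [IsScalarTower A S T]
    {u v : MvPowerSeries τ S} {a : τ → MvPowerSeries υ T}
    (hu : MvPowerSeries.constantCoeff u = 0) (hv : MvPowerSeries.constantCoeff v = 0)
    (ha : MvPowerSeries.HasSubst a) (f : MvPowerSeries (Fin 2) A) :
    (f.subst ![u, v]).subst a = f.subst ![u.subst a, v.subst a] := by
  rw [MvPowerSeries.subst_comp_subst_apply (hasSubst_vec hu hv) ha]
  congr 1
  funext i
  fin_cases i <;> rfl

lemma constantCoeff_subst_vec {A S : Type*} [CommRing A] [CommRing S] [Algebra A S]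
    {u v : MvPowerSeries τ S} (hu : MvPowerSeries.constantCoeff u = 0)
    (hv : MvPowerSeries.constantCoeff v = 0) {f : MvPowerSeries (Fin 2) A}
    (hf : MvPowerSeries.constantCoeff f = 0) :
    MvPowerSeries.constantCoeff (f.subst ![u, v]) = 0 :=
  MvPowerSeries.constantCoeff_subst_eq_zero (hasSubst_vec hu hv)
    (fun i => by fin_cases i <;> simp [hu, hv]) hf

lemma constantCoeff_subst_zero {S : Type*} [CommRing S] [Algebra R S]
    {u : MvPowerSeries τ R} {a : τ → MvPowerSeries υ S}
    (ha : ∀ i, MvPowerSeries.constantCoeff (a i) = 0)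
    (ha' : MvPowerSeries.HasSubst a) (hu : MvPowerSeries.constantCoeff u = 0) :
    MvPowerSeries.constantCoeff (u.subst a) = 0 :=
  MvPowerSeries.constantCoeff_subst_eq_zero ha' ha hu

lemma isUnit_one_add {u : MvPowerSeries τ R} (hu : MvPowerSeries.constantCoeff u = 0) :
    IsUnit (1 + u) := by
  rw [MvPowerSeries.isUnit_iff_constantCoeff]
  simp [hu]

/-- The difference of two values of a power series is divisible by the difference of the
arguments. -/
lemma sub_mul_subst_diffQuot {S : Type*} [CommRing S] [Algebra R S] {u v : MvPowerSeries τ S}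
    (hu : MvPowerSeries.constantCoeff u = 0)
    (hv : MvPowerSeries.constantCoeff v = 0) (a : R⟦X⟧) :
    (v - u) * (diffQuot a).subst ![u, v] = a.subst v - a.subst u := by
  have hX (i : Fin 2) : PowerSeries.HasSubst (MvPowerSeries.X i : MvPowerSeries (Fin 2) R) :=
    PowerSeries.HasSubst.X i
  have hp := hasSubst_vec hu hv
  have h := congrArg (MvPowerSeries.subst (S := S) ![u, v]) (X_sub_X_mul_diffQuot a)
  rw [MvPowerSeries.subst_mul hp, MvPowerSeries.subst_sub hp, MvPowerSeries.subst_sub hp,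
    MvPowerSeries.subst_X hp, MvPowerSeries.subst_X hp, PowerSeries.subst,
    MvPowerSeries.subst_comp_subst_apply (hX 1).const hp, PowerSeries.subst,
    MvPowerSeries.subst_comp_subst_apply (hX 0).const hp] at h
  simp_rw [MvPowerSeries.subst_X hp] at h
  exact h

lemma subst_sub_dvd {S : Type*} [CommRing S] [Algebra R S] {u v : MvPowerSeries τ S}
    (hu : MvPowerSeries.constantCoeff u = 0)
    (hv : MvPowerSeries.constantCoeff v = 0) (a : R⟦X⟧) : v - u ∣ a.subst v - a.subst u :=
  ⟨_, (sub_mul_subst_diffQuot hu hv a).symm⟩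

end Subst

/-! ### Functions on the curve near the point at infinity -/

section Curve

variable {R : Type*} [CommRing R] [Algebra (ZMod 2) R] {τ υ : Type*}

/-- The value `w(u)`: the points of the curve near infinity are the `(u, w(u))`. -/
def wAt (u : MvPowerSeries τ R) : MvPowerSeries τ R := PowerSeries.subst u curveW

/-- The slope of the chord through the points with coordinates `u` and `v`. -/
def slopeAt (u v : MvPowerSeries τ R) : MvPowerSeries τ R := curveSlope.subst ![u, v]

/-- The coordinate of the third point on the chord through the points with coordinates `u`
and `v`. -/
def thirdAt (u v : MvPowerSeries τ R) : MvPowerSeries τ R := u + v + slopeAt u v ^ 2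

/-- The sum `F(u, v)` with respect to the formal group law. -/
def fadd (u v : MvPowerSeries τ R) : MvPowerSeries τ R := (fgl R).subst ![u, v]

lemma curveW_eq : curveW = PowerSeries.X ^ 3 + curveW ^ 2 := by
  have h : PowerSeries.expand 2 two_ne_zero curveW = curveW ^ 2 := by
    have := MvPowerSeries.map_frobenius_expand (σ := Unit) (R := ZMod 2) 2 two_ne_zero
      (f := curveW)
    rw [ZMod.frobenius_zmod, MvPowerSeries.map_id] at this
    exact this
  rw [← h]
  ext n
  rw [map_add, PowerSeries.coeff_X_pow, PowerSeries.coeff_expand]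
  simp only [curveW, PowerSeries.coeff_mk]
  have key : (∃ j : ℕ, n = 3 * 2 ^ j) ↔ n = 3 ∨ (2 ∣ n ∧ ∃ j : ℕ, n / 2 = 3 * 2 ^ j) := by
    constructor
    · rintro ⟨j, rfl⟩
      cases j with
      | zero => simp
      | succ j => exact Or.inr ⟨⟨3 * 2 ^ j, by ring⟩, j, by rw [pow_succ]; omega⟩
    · rintro (rfl | ⟨h2, j, hj⟩)
      · exact ⟨0, rfl⟩
      · exact ⟨j + 1, by rw [pow_succ]; omega⟩
  by_cases h3 : n = 3
  · subst h3
    simp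
  · rw [if_neg h3, zero_add]
    by_cases hn : ∃ j : ℕ, n = 3 * 2 ^ j
    · obtain ⟨h2, h2'⟩ := (key.mp hn).resolve_left h3
      rw [if_pos hn, if_pos h2, if_pos h2']
    · rw [if_neg hn]
      split_ifs with h2 h2'
      · exact absurd (key.mpr (Or.inr ⟨h2, h2'⟩)) hn
      · rfl
      · rfl

lemma constantCoeff_curveW : PowerSeries.constantCoeff curveW = 0 := by
  rw [← PowerSeries.coeff_zero_eq_constantCoeff_apply, curveW, PowerSeries.coeff_mk, if_neg]
  rintro ⟨j, hj⟩
  simp at hj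

lemma constantCoeff_curveSlope : MvPowerSeries.constantCoeff curveSlope = 0 := by
  rw [← MvPowerSeries.coeff_zero_eq_constantCoeff_apply]
  change PowerSeries.coeff 1 curveW = 0
  rw [curveW, PowerSeries.coeff_mk, if_neg]
  rintro ⟨j, hj⟩
  omega

variable {u v : MvPowerSeries τ R}

lemma constantCoeff_wAt (hu : MvPowerSeries.constantCoeff u = 0) :
    MvPowerSeries.constantCoeff (wAt u) = 0 :=
  PowerSeries.constantCoeff_subst_eq_zero hu _ constantCoeff_curveW

lemma constantCoeff_slopeAt (hu : MvPowerSeries.constantCoeff u = 0)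
    (hv : MvPowerSeries.constantCoeff v = 0) :
    MvPowerSeries.constantCoeff (slopeAt u v) = 0 :=
  constantCoeff_subst_vec hu hv constantCoeff_curveSlope

lemma constantCoeff_thirdAt (hu : MvPowerSeries.constantCoeff u = 0)
    (hv : MvPowerSeries.constantCoeff v = 0) :
    MvPowerSeries.constantCoeff (thirdAt u v) = 0 := by
  simp [thirdAt, hu, hv, constantCoeff_slopeAt hu hv]

lemma constantCoeff_fadd (hu : MvPowerSeries.constantCoeff u = 0)
    (hv : MvPowerSeries.constantCoeff v = 0) :
    MvPowerSeries.constantCoeff (fadd u v) = 0 :=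
  constantCoeff_subst_vec hu hv (constantCoeff_fgl R)

section Naturality

variable {S : Type*} [CommRing S] [Algebra (ZMod 2) S] [Algebra R S] [IsScalarTower (ZMod 2) R S]
  {a : τ → MvPowerSeries υ S}

lemma subst_wAt (ha : MvPowerSeries.HasSubst a) (hu : MvPowerSeries.constantCoeff u = 0) :
    (wAt u).subst a = wAt (u.subst a) := by
  rw [wAt, wAt, PowerSeries.subst, MvPowerSeries.subst_comp_subst_apply
    (PowerSeries.HasSubst.of_constantCoeff_zero hu).const ha]
  rfl

lemma fadd_eq (hu : MvPowerSeries.constantCoeff u = 0)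
    (hv : MvPowerSeries.constantCoeff v = 0) : fadd u v = curveFGL.subst ![u, v] := by
  rw [fadd, fgl, MvPowerSeries.map_algebraMap_eq_subst_X,
    MvPowerSeries.subst_comp_subst_apply MvPowerSeries.HasSubst.X (hasSubst_vec hu hv)]
  simp_rw [MvPowerSeries.subst_X (hasSubst_vec hu hv)]

lemma subst_fadd (ha' : ∀ i, MvPowerSeries.constantCoeff (a i) = 0)
    (ha : MvPowerSeries.HasSubst a) (hu : MvPowerSeries.constantCoeff u = 0)
    (hv : MvPowerSeries.constantCoeff v = 0) :
    (fadd u v).subst a = fadd (u.subst a) (v.subst a) := by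
  rw [fadd_eq hu hv, fadd_eq (constantCoeff_subst_zero ha' ha hu)
    (constantCoeff_subst_zero ha' ha hv), subst_vec_comp hu hv ha]

end Naturality

lemma wAt_add_sq (hu : MvPowerSeries.constantCoeff u = 0) : wAt u = u ^ 3 + wAt u ^ 2 := by
  have h := PowerSeries.HasSubst.of_constantCoeff_zero hu
  have h1 := congrArg (PowerSeries.subst u) curveW_eq
  rwa [PowerSeries.subst_add h, PowerSeries.subst_pow h, PowerSeries.subst_pow h,
    PowerSeries.subst_X h] at h1

/-- The equation `w = u³ + w²` has only one solution without constant term. -/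
lemma eq_wAt {w : MvPowerSeries τ R} (hu : MvPowerSeries.constantCoeff u = 0)
    (hw : MvPowerSeries.constantCoeff w = 0) (h : w = u ^ 3 + w ^ 2) : w = wAt u := by
  have h2 := two_eq_zero (MvPowerSeries τ R)
  have h1 := wAt_add_sq hu
  have hunit : IsUnit (1 + (w + wAt u)) := isUnit_one_add (by simp [hw, constantCoeff_wAt hu])
  refine sub_eq_zero.mp (hunit.mul_left_eq_zero.mp ?_)
  linear_combination h - h1 + (w ^ 2 - wAt u ^ 2) * h2

lemma wAt_zero : wAt (0 : MvPowerSeries τ R) = 0 :=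
  (eq_wAt (by simp) (by simp) (by simp)).symm

lemma sub_mul_slopeAt (hu : MvPowerSeries.constantCoeff u = 0)
    (hv : MvPowerSeries.constantCoeff v = 0) : (v - u) * slopeAt u v = wAt v - wAt u :=
  sub_mul_subst_diffQuot hu hv curveW

lemma thirdAt_eq_subst (hu : MvPowerSeries.constantCoeff u = 0)
    (hv : MvPowerSeries.constantCoeff v = 0) : curveThird.subst ![u, v] = thirdAt u v := by
  have h := hasSubst_vec hu hv
  rw [curveThird, MvPowerSeries.subst_add h, MvPowerSeries.subst_add h, MvPowerSeries.subst_pow h,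
    MvPowerSeries.subst_X h, MvPowerSeries.subst_X h]
  rfl

lemma fadd_mul_one_add (hu : MvPowerSeries.constantCoeff u = 0)
    (hv : MvPowerSeries.constantCoeff v = 0) :
    fadd u v * (1 + wAt (thirdAt u v)) = thirdAt u v := by
  have h := hasSubst_vec hu hv
  have h0 := constantCoeff_curveThird
  have h1 : curveFGL * (1 + wAt curveThird) = curveThird := by
    rw [curveFGL, mul_assoc]
    change curveThird * ((1 + wAt curveThird)⁻¹ * (1 + wAt curveThird)) = _
    rw [MvPowerSeries.inv_mul_cancel _ (by simp [constantCoeff_wAt h0]), mul_one]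
  have h2 := congrArg (MvPowerSeries.subst ![u, v]) h1
  rw [MvPowerSeries.subst_mul h, MvPowerSeries.subst_add h, subst_wAt h h0,
    thirdAt_eq_subst hu hv, ← fadd_eq hu hv, ← MvPowerSeries.coe_substAlgHom h, map_one] at h2
  exact h2

/-- The slope `s` of the generic chord satisfies a quadratic equation: `z³ - w(z) - w(z)²` takes the
same value at both points, and the difference of the points can be cancelled. -/
lemma slope_generic :
    (MvPowerSeries.X 0 ^ 2 + MvPowerSeries.X 0 * MvPowerSeries.X 1 + MvPowerSeries.X 1 ^ 2 +
      curveSlope ^ 2 * (MvPowerSeries.X 0 + MvPowerSeries.X 1) + curveSlope :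
        MvPowerSeries (Fin 2) (ZMod 2)) = 0 := by
  set x : MvPowerSeries (Fin 2) (ZMod 2) := MvPowerSeries.X 0 with hx
  set y : MvPowerSeries (Fin 2) (ZMod 2) := MvPowerSeries.X 1 with hy
  have hne : y - x ≠ 0 := by
    rw [sub_ne_zero]
    intro h
    exact absurd (MvPowerSeries.X_inj.mp h) (by decide)
  have h2 := two_eq_zero (MvPowerSeries (Fin 2) (ZMod 2))
  have hs : (y - x) * curveSlope = wAt y - wAt x := X_sub_X_mul_diffQuot curveW
  have hwx := wAt_add_sq (u := x) (by simp [hx])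
  have hwy := wAt_add_sq (u := y) (by simp [hy])
  refine (mul_eq_zero.mp ?_).resolve_left hne
  generalize wAt x = a at *
  generalize wAt y = b at *
  generalize curveSlope = s at *
  grind

lemma slope_quadratic (hu : MvPowerSeries.constantCoeff u = 0)
    (hv : MvPowerSeries.constantCoeff v = 0) :
    u ^ 2 + u * v + v ^ 2 + slopeAt u v ^ 2 * (u + v) + slopeAt u v = 0 := by
  have h := hasSubst_vec hu hv
  have h1 := congrArg (MvPowerSeries.substAlgHom (S := R) h) slope_generic
  simp only [map_add, map_mul, map_pow, map_zero, MvPowerSeries.substAlgHom_X] at h1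
  rw [MvPowerSeries.coe_substAlgHom] at h1
  exact h1

end Curve

/-! ### Addition of points near infinity -/

section Addition

variable {R : Type*} [CommRing R] [Algebra (ZMod 2) R] {τ υ : Type*} {u v : MvPowerSeries τ R}

/-- The third intersection point lies on the chord. -/
lemma wAt_thirdAt (hu : MvPowerSeries.constantCoeff u = 0)
    (hv : MvPowerSeries.constantCoeff v = 0) :
    wAt (thirdAt u v) = wAt u + slopeAt u v * (thirdAt u v + u) := by
  have h2 := two_eq_zero (MvPowerSeries τ R)
  have hT := constantCoeff_thirdAt hu hv
  refine (eq_wAt hT (by simp [constantCoeff_wAt hu, constantCoeff_slopeAt hu hv, hT, hu]) ?_).symm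
  have hq := slope_quadratic hu hv
  have hw := wAt_add_sq hu
  simp only [thirdAt]
  generalize slopeAt u v = s at *
  generalize wAt u = a at *
  grind

/-- The quadratic equation of the slope has only one solution without constant term. -/
lemma eq_slopeAt {s : MvPowerSeries τ R} (hu : MvPowerSeries.constantCoeff u = 0)
    (hv : MvPowerSeries.constantCoeff v = 0) (hs : MvPowerSeries.constantCoeff s = 0)
    (h : u ^ 2 + u * v + v ^ 2 + s ^ 2 * (u + v) + s = 0) : s = slopeAt u v := by
  have hq := slope_quadratic hu hv
  have hs' := constantCoeff_slopeAt hu hv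
  have hunit : IsUnit (1 + (s + slopeAt u v) * (u + v)) :=
    isUnit_one_add (by simp [hs, hs'])
  refine sub_eq_zero.mp (hunit.mul_left_eq_zero.mp ?_)
  linear_combination h - hq

lemma eq_fadd {f : MvPowerSeries τ R} (hu : MvPowerSeries.constantCoeff u = 0)
    (hv : MvPowerSeries.constantCoeff v = 0) (h : f * (1 + wAt (thirdAt u v)) = thirdAt u v) :
    f = fadd u v := by
  have hunit : IsUnit (1 + wAt (thirdAt u v)) :=
    isUnit_one_add (constantCoeff_wAt (constantCoeff_thirdAt hu hv))
  exact hunit.mul_right_cancel (h.trans (fadd_mul_one_add hu hv).symm)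

lemma slopeAt_comm (hu : MvPowerSeries.constantCoeff u = 0)
    (hv : MvPowerSeries.constantCoeff v = 0) : slopeAt u v = slopeAt v u :=
  eq_slopeAt hv hu (constantCoeff_slopeAt hu hv) (by linear_combination slope_quadratic hu hv)

lemma fadd_comm (hu : MvPowerSeries.constantCoeff u = 0)
    (hv : MvPowerSeries.constantCoeff v = 0) : fadd u v = fadd v u := by
  have hT : thirdAt v u = thirdAt u v := by
    rw [thirdAt, thirdAt, slopeAt_comm hv hu]
    ring
  apply eq_fadd hv hu
  rw [hT]
  exact fadd_mul_one_add hu hv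

lemma zero_fadd (hu : MvPowerSeries.constantCoeff u = 0) : fadd 0 u = u := by
  have h0 : MvPowerSeries.constantCoeff (0 : MvPowerSeries τ R) = 0 := map_zero _
  have h2 := two_eq_zero (MvPowerSeries τ R)
  refine (eq_fadd h0 hu ?_).symm
  rw [wAt_thirdAt h0 hu, wAt_zero]
  have hq := slope_quadratic h0 hu
  simp only [thirdAt]
  generalize slopeAt 0 u = s at *
  linear_combination s * hq - s ^ 2 * h2

/-- Doubling: the tangent at `u` has slope `u²` and meets the curve again at `u⁴`. -/
lemma fadd_self_mul (hu : MvPowerSeries.constantCoeff u = 0) :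
    fadd u u * (1 + wAt (u ^ 4)) = u ^ 4 := by
  have h2 := two_eq_zero (MvPowerSeries τ R)
  have hs : u ^ 2 = slopeAt u u :=
    eq_slopeAt hu hu (by simp [hu]) (by linear_combination (2 * u ^ 2 + u ^ 5) * h2)
  have hT : thirdAt u u = u ^ 4 := by
    rw [thirdAt, ← hs]
    linear_combination u * h2
  have := fadd_mul_one_add hu hu
  rwa [hT] at this

/-- The formal inverse: the negative of `(u, w)` is `(u / (1 + w), w / (1 + w))`. -/
def fneg (u : MvPowerSeries τ R) : MvPowerSeries τ R := u * Ring.inverse (1 + wAt u)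

lemma fneg_mul_one_add (hu : MvPowerSeries.constantCoeff u = 0) :
    fneg u * (1 + wAt u) = u := by
  rw [fneg, mul_assoc, Ring.inverse_mul_cancel _ (isUnit_one_add (constantCoeff_wAt hu)), mul_one]

lemma constantCoeff_fneg (hu : MvPowerSeries.constantCoeff u = 0) :
    MvPowerSeries.constantCoeff (fneg u) = 0 := by
  simp [fneg, hu]

lemma fadd_fneg (hu : MvPowerSeries.constantCoeff u = 0) : fadd u (fneg u) = 0 := by
  have h2 := two_eq_zero (MvPowerSeries τ R)
  have hv := constantCoeff_fneg hu
  have h := fneg_mul_one_add hu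
  have hw := wAt_add_sq hu
  have hunit : IsUnit (1 + wAt u) := isUnit_one_add (constantCoeff_wAt hu)
  generalize fneg u = v at *
  have h3 : v ^ 3 * (1 + wAt u) ^ 2 = wAt u := by
    apply hunit.mul_right_cancel
    generalize wAt u = w at *
    subst h
    linear_combination -hw - w ^ 2 * h2
  have hs : u * v = slopeAt u v := by
    refine eq_slopeAt hu hv (by simp [hu]) ?_
    generalize wAt u = w at *
    subst h
    grind
  have hT : thirdAt u v = 0 := by
    rw [thirdAt, ← hs]
    generalize wAt u = w at *
    subst h
    grind
  have := fadd_mul_one_add hu hv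
  rwa [hT, wAt_zero, add_zero, mul_one] at this

lemma fadd_self (hu : MvPowerSeries.constantCoeff u = 0) : fadd u u = fneg (u ^ 4) := by
  have h4 : MvPowerSeries.constantCoeff (u ^ 4) = 0 := by simp [hu]
  have hunit : IsUnit (1 + wAt (u ^ 4)) := isUnit_one_add (constantCoeff_wAt h4)
  exact hunit.mul_right_cancel ((fadd_self_mul hu).trans (fneg_mul_one_add h4).symm)

/-- The formal group law is defined over `𝔽₂`, so it commutes with squaring. -/
lemma fadd_sq (hu : MvPowerSeries.constantCoeff u = 0)
    (hv : MvPowerSeries.constantCoeff v = 0) : fadd (u ^ 2) (v ^ 2) = fadd u v ^ 2 := by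
  have h2 := two_eq_zero (MvPowerSeries τ R)
  have hu2 : MvPowerSeries.constantCoeff (u ^ 2) = 0 := by simp [hu]
  have hv2 : MvPowerSeries.constantCoeff (v ^ 2) = 0 := by simp [hv]
  have hs : slopeAt u v ^ 2 = slopeAt (u ^ 2) (v ^ 2) := by
    refine eq_slopeAt hu2 hv2 (by simp [constantCoeff_slopeAt hu hv]) ?_
    have hq := slope_quadratic hu hv
    generalize slopeAt u v = s at *
    grind
  have hT : thirdAt (u ^ 2) (v ^ 2) = thirdAt u v ^ 2 := by
    rw [thirdAt, thirdAt, ← hs]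
    generalize slopeAt u v = s at *
    grind
  have hW : wAt (thirdAt u v) ^ 2 = wAt (thirdAt u v ^ 2) := by
    have h0 := constantCoeff_thirdAt hu hv
    refine eq_wAt (by simp [h0]) (by simp [constantCoeff_wAt h0]) ?_
    have hw := wAt_add_sq h0
    generalize wAt (thirdAt u v) = w at *
    generalize thirdAt u v = T at *
    grind
  refine (eq_fadd hu2 hv2 ?_).symm
  rw [hT, ← hW]
  have hf := fadd_mul_one_add hu hv
  generalize wAt (thirdAt u v) = w at *
  generalize thirdAt u v = T at *
  generalize fadd u v = f at *
  grind

/-- The solutions of `c⁴ = c` act on the formal group, since all monomials of the formal group law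
have degree congruent to `1` modulo `3`. -/
lemma fadd_mul_left {c : MvPowerSeries τ R} (hc : c ^ 4 = c)
    (hu : MvPowerSeries.constantCoeff u = 0) (hv : MvPowerSeries.constantCoeff v = 0) :
    fadd (c * u) (c * v) = c * fadd u v := by
  have hcu : MvPowerSeries.constantCoeff (c * u) = 0 := by simp [hu]
  have hcv : MvPowerSeries.constantCoeff (c * v) = 0 := by simp [hv]
  have hs : c ^ 2 * slopeAt u v = slopeAt (c * u) (c * v) := by
    refine eq_slopeAt hcu hcv (by simp [constantCoeff_slopeAt hu hv]) ?_
    have hq := slope_quadratic hu hv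
    generalize slopeAt u v = s at *
    linear_combination c ^ 2 * hq + c * s ^ 2 * (u + v) * hc
  have hT : thirdAt (c * u) (c * v) = c * thirdAt u v := by
    rw [thirdAt, thirdAt, ← hs]
    linear_combination slopeAt u v ^ 2 * hc
  have hW : c ^ 3 * wAt (thirdAt u v) = wAt (c * thirdAt u v) := by
    have h0 := constantCoeff_thirdAt hu hv
    refine eq_wAt (by simp [h0]) (by simp [constantCoeff_wAt h0]) ?_
    linear_combination c ^ 3 * wAt_add_sq h0 - c ^ 2 * wAt (thirdAt u v) ^ 2 * hc
  refine (eq_fadd hcu hcv ?_).symm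
  rw [hT, ← hW]
  linear_combination c * fadd_mul_one_add hu hv + fadd u v * wAt (thirdAt u v) * hc

/-- `F(u, v) = u + v · (1 + ⋯)`. -/
lemma exists_fadd_eq (hu : MvPowerSeries.constantCoeff u = 0)
    (hv : MvPowerSeries.constantCoeff v = 0) :
    ∃ q : MvPowerSeries τ R, MvPowerSeries.constantCoeff q = 1 ∧ fadd u v = u + v * q := by
  have h2 := two_eq_zero (MvPowerSeries τ R)
  have h0 : MvPowerSeries.constantCoeff (0 : MvPowerSeries τ R) = 0 := map_zero _
  have hW0 := constantCoeff_wAt (constantCoeff_thirdAt hu hv)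
  obtain ⟨i, hi⟩ := (isUnit_one_add hW0).exists_right_inv
  have hi0 : MvPowerSeries.constantCoeff i = 1 := by
    simpa [hW0] using congrArg MvPowerSeries.constantCoeff hi
  refine ⟨i * (1 + u * slopeAt 0 v + slopeAt u v * (u + v + slopeAt u v ^ 2)),
    by simp [hi0, hu, constantCoeff_slopeAt hu hv], ?_⟩
  have hf := fadd_mul_one_add hu hv
  have hs0 := sub_mul_slopeAt h0 hv
  have hs := sub_mul_slopeAt hu hv
  have hq := slope_quadratic hu hv
  have hwT := wAt_thirdAt hu hv
  rw [wAt_zero] at hs0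
  have key : thirdAt u v - u * (1 + wAt (thirdAt u v)) =
      v * (1 + u * slopeAt 0 v + slopeAt u v * (u + v + slopeAt u v ^ 2)) := by
    rw [hwT, thirdAt]
    generalize slopeAt u v = s at *
    generalize slopeAt 0 v = s' at *
    generalize wAt u = a at *
    generalize wAt v = b at *
    linear_combination -s * hq - u * hs + u * hs0 + (s ^ 2 - u * v * s' - u ^ 2 * s) * h2
  linear_combination (fadd u v - u) * (-hi) + i * hf + i * key

end Addition

/-! ### Associativity from the group law of the elliptic curve -/

section Associativity

/-- The sum of two points is the negative `(T / (1 + c), c / (1 + c))` of the third point `(T, c)` on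
the chord. This is the statement for the second coordinate. -/
lemma wAt_fadd_mul {R : Type*} [CommRing R] [Algebra (ZMod 2) R] {τ : Type*}
    {u v : MvPowerSeries τ R} (hu : MvPowerSeries.constantCoeff u = 0)
    (hv : MvPowerSeries.constantCoeff v = 0) :
    wAt (fadd u v) * (1 + wAt (thirdAt u v)) = wAt (thirdAt u v) := by
  have h2 := two_eq_zero (MvPowerSeries τ R)
  have hT := constantCoeff_thirdAt hu hv
  have hf := fadd_mul_one_add hu hv
  have hW := wAt_add_sq hT
  obtain ⟨i, hi⟩ := (isUnit_one_add (constantCoeff_wAt hT)).exists_right_inv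
  have key : wAt (thirdAt u v) * i = wAt (fadd u v) := by
    refine eq_wAt (constantCoeff_fadd hu hv) (by simp [constantCoeff_wAt hT]) ?_
    have hfi : fadd u v = thirdAt u v * i := by linear_combination i * hf - fadd u v * hi
    rw [hfi]
    generalize wAt (thirdAt u v) = w at *
    generalize thirdAt u v = T at *
    have hT3 : T ^ 3 = w * (1 + w) := by linear_combination -hW - w ^ 2 * h2
    have e : T ^ 3 * i ^ 3 = w * i ^ 2 := by
      rw [hT3]
      linear_combination w * i ^ 2 * hi
    rw [mul_pow, e]
    linear_combination (-w * i) * hi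
  rw [← key]
  linear_combination wAt (thirdAt u v) * hi

variable (K : Type*) [Field K]

/-- The elliptic curve `y² + y = x³`. -/
def ellCurve : WeierstrassCurve K := ⟨0, 0, 1, 0, 0⟩

instance [CharP K 2] : (ellCurve K).IsElliptic where
  isUnit := by
    have h2 : (2 : K) = 0 := CharTwo.two_eq_zero
    have : (ellCurve K).Δ = 1 := by
      simp only [ellCurve, WeierstrassCurve.Δ, WeierstrassCurve.b₂, WeierstrassCurve.b₄,
        WeierstrassCurve.b₆, WeierstrassCurve.b₈]
      linear_combination -14 * h2
    rw [this]
    exact isUnit_one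

variable {K}

lemma ellCurve_equation {u w : K} (hw : w ≠ 0) (h : w = u ^ 3 + w ^ 2) (h2 : (2 : K) = 0) :
    (ellCurve K).toAffine.Equation (u / w) (1 / w) := by
  rw [WeierstrassCurve.Affine.equation_iff]
  simp only [ellCurve]
  field_simp
  linear_combination h + w ^ 2 * h2

/-- The affine point with coordinates `x = u / w` and `y = 1 / w`. -/
def curvePoint [CharP K 2] (u w : K) (hw : w ≠ 0) (h : w = u ^ 3 + w ^ 2) :
    (ellCurve K).toAffine.Point :=
  .some (u / w) (1 / w) ((WeierstrassCurve.Affine.equation_iff_nonsingular).mp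
    (ellCurve_equation hw h CharTwo.two_eq_zero))

open Classical in
/-- The chord construction: if `(T, c)` is the third point on the line `w = s z + γ` through
`(u, a)` and `(v, b)`, then the sum of the latter two points is the negative `(f, d)` of `(T, c)`,
that is, `f = T / (1 + c)` and `d = c / (1 + c)`. -/
lemma curvePoint_add [CharP K 2] {u v T a b c s f d : K} (ha : a ≠ 0) (hb : b ≠ 0) (hd : d ≠ 0)
    (hau : a = u ^ 3 + a ^ 2) (hbv : b = v ^ 3 + b ^ 2) (hfd : d = f ^ 3 + d ^ 2)
    (hne : u * b ≠ v * a) (hT : T = u + v + s ^ 2)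
    (hs : (v - u) * s = b - a)
    (hq : u ^ 2 + u * v + v ^ 2 + s ^ 2 * (u + v) + s = 0)
    (hc : c = a + s * (T + u)) (hf : f * (1 + c) = T) (hdc : d * (1 + c) = c) :
    curvePoint u a ha hau + curvePoint v b hb hbv = curvePoint f d hd hfd := by
  have h2 : (2 : K) = 0 := CharTwo.two_eq_zero
  have hx : u / a ≠ v / b := by
    rwa [Ne, div_eq_div_iff ha hb]
  have hc1 : 1 + c ≠ 0 := by
    intro h
    rw [h, mul_zero] at hf hdc
    rw [← hdc, add_zero] at h
    exact one_ne_zero h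
  have hc0 : c ≠ 0 := by
    rintro rfl
    rw [add_zero, mul_one] at hdc
    exact hd hdc
  obtain ⟨γ, hγ⟩ : ∃ γ, γ = a + s * u := ⟨_, rfl⟩
  have hγ0 : γ ≠ 0 := by
    intro h
    apply hne
    have hb' : b = s * v := by linear_combination -hs - hγ + h - s * u * h2
    have ha' : a = s * u := by linear_combination -hγ + h - s * u * h2
    rw [ha', hb']
    ring
  have hslope : (ellCurve K).toAffine.slope (u / a) (v / b) (1 / a) (1 / b) = s / γ := by
    rw [WeierstrassCurve.Affine.slope_of_X_ne hx, div_eq_div_iff (sub_ne_zero.mpr hx) hγ0]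
    have e : (b - a) * γ = s * (u * b - v * a) := by
      linear_combination (b - a) * hγ + a * hs + a * (b - a) * h2
    field_simp
    linear_combination e
  have habc : a * b * c = γ ^ 3 := by
    clear * - h2 hau hT hs hq hc hγ
    grind
  have hnum : u * b * c + v * a * c + T * a * b = s ^ 2 * γ := by
    clear * - h2 hau hT hs hq hc hγ
    grind
  have hX : (s / γ) ^ 2 + u / a + v / b = T / c := by
    have e : s ^ 2 / γ ^ 2 = (u * b * c + v * a * c + T * a * b) / (a * b * c) := by
      rw [hnum, habc]
      field_simp
    rw [div_pow, e]
    field_simp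
    linear_combination (u * b * c + v * a * c) * h2
  have hx3 : f / d = T / c := by
    rw [div_eq_div_iff hd hc0]
    have : (1 + c) * (f * c) = (1 + c) * (T * d) := by
      linear_combination c * hf - T * hdc
    exact mul_left_cancel₀ hc1 this
  have hy3 : 1 / d = 1 / c + 1 := by
    field_simp
    linear_combination -hdc
  have hY : (s / γ) * (T / c - u / a) + 1 / a = 1 / c := by
    have e : s * (T * a - u * c) + γ * c = γ * a := by
      clear * - h2 hγ hc
      grind
    field_simp
    linear_combination e
  have hX' : (ellCurve K).toAffine.addX (u / a) (v / b) (s / γ) = T / c := by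
    rw [← hX]
    simp only [WeierstrassCurve.Affine.addX, ellCurve]
    linear_combination (-(u / a) - v / b) * h2
  unfold curvePoint
  rw [WeierstrassCurve.Affine.Point.add_of_X_ne hx]
  simp only [WeierstrassCurve.Affine.Point.some.injEq, hslope]
  refine ⟨hX'.trans hx3.symm, ?_⟩
  rw [WeierstrassCurve.Affine.addY, WeierstrassCurve.Affine.negAddY, hX', hY, hy3,
    WeierstrassCurve.Affine.negY]
  simp only [ellCurve]
  linear_combination (-(1 / c) - 1) * h2

/-- Power series `u`, `v` without constant term have different `x`-coordinates as soon as some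
substitution sends `v` but not `u` to `0`. -/
lemma mul_wAt_ne {τ υ : Type*} {u v : MvPowerSeries τ (ZMod 2)}
    {a : τ → MvPowerSeries υ (ZMod 2)}
    (ha : MvPowerSeries.HasSubst a) (hu : MvPowerSeries.constantCoeff u = 0)
    (hv : MvPowerSeries.constantCoeff v = 0) (hv0 : v ≠ 0) (h0 : v.subst a = 0)
    (h1 : u.subst a ≠ 0) : u * wAt v ≠ v * wAt u := by
  intro h
  have h2 := two_eq_zero (MvPowerSeries τ (ZMod 2))
  have hu0 : u ≠ 0 := by
    rintro rfl
    apply h1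
    rw [← MvPowerSeries.coe_substAlgHom ha, map_zero]
  have hwu := wAt_add_sq hu
  have hwv := wAt_add_sq hv
  -- `u³ = w(u) (1 + w(u))`, so the hypothesis says `v² (1 + w(u)) = u² (1 + w(v))`.
  have key : u * v * (v ^ 2 * (1 + wAt u) - u ^ 2 * (1 + wAt v)) = 0 := by
    linear_combination (1 + wAt u) * (1 + wAt v) * h - u * (1 + wAt u) * hwv +
      v * (1 + wAt v) * hwu - u * (1 + wAt u) * wAt v ^ 2 * h2 +
      v * (1 + wAt v) * wAt u ^ 2 * h2
  have key2 := (mul_eq_zero.mp key).resolve_left (mul_ne_zero hu0 hv0)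
  have key3 := congrArg (MvPowerSeries.substAlgHom (S := ZMod 2) ha) key2
  simp only [map_sub, map_mul, map_pow, map_add, map_one, map_zero] at key3
  simp only [MvPowerSeries.coe_substAlgHom] at key3
  rw [subst_wAt ha hv, subst_wAt ha hu, h0, wAt_zero, add_zero, mul_one,
    zero_pow two_ne_zero, zero_mul, zero_sub, neg_eq_zero] at key3
  exact h1 (pow_eq_zero_iff two_ne_zero |>.mp key3)

variable {τ : Type*}

lemma wAt_ne_zero {u : MvPowerSeries τ (ZMod 2)} (hu : MvPowerSeries.constantCoeff u = 0)
    (h : u ≠ 0) : wAt u ≠ 0 := by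
  intro h0
  have := wAt_add_sq hu
  rw [h0, zero_pow two_ne_zero, add_zero] at this
  exact h (pow_eq_zero_iff three_ne_zero |>.mp this.symm)

/-- The point of the elliptic curve over an extension field `K` of a power series ring with
parameter `u`. -/
def seriesPoint [CharP K 2] {φ : MvPowerSeries τ (ZMod 2) →+* K} (hφ : Function.Injective φ)
    (u : MvPowerSeries τ (ZMod 2)) (hu : MvPowerSeries.constantCoeff u = 0) (h : u ≠ 0) :
    (ellCurve K).toAffine.Point :=
  curvePoint (φ u) (φ (wAt u)) ((map_ne_zero_iff _ hφ).mpr (wAt_ne_zero hu h))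
    (by rw [← map_pow, ← map_pow, ← map_add, ← wAt_add_sq hu])

lemma seriesPoint_injective [CharP K 2] {φ : MvPowerSeries τ (ZMod 2) →+* K}
    (hφ : Function.Injective φ) {u v : MvPowerSeries τ (ZMod 2)}
    {hu : MvPowerSeries.constantCoeff u = 0} {hv : MvPowerSeries.constantCoeff v = 0}
    {hu0 : u ≠ 0} {hv0 : v ≠ 0} (h : seriesPoint hφ u hu hu0 = seriesPoint hφ v hv hv0) :
    u = v := by
  simp only [seriesPoint, curvePoint, WeierstrassCurve.Affine.Point.some.injEq] at h
  obtain ⟨h1, h2⟩ := h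
  have hwu := (map_ne_zero_iff _ hφ).mpr (wAt_ne_zero hu hu0)
  have hwv := (map_ne_zero_iff _ hφ).mpr (wAt_ne_zero hv hv0)
  have e : wAt u = wAt v := by
    apply hφ
    rw [div_eq_div_iff hwu hwv] at h2
    linear_combination -h2
  rw [e, div_left_inj' hwv] at h1
  exact hφ h1

open Classical in
lemma seriesPoint_add [CharP K 2] {φ : MvPowerSeries τ (ZMod 2) →+* K}
    (hφ : Function.Injective φ) {u v : MvPowerSeries τ (ZMod 2)}
    (hu : MvPowerSeries.constantCoeff u = 0) (hv : MvPowerSeries.constantCoeff v = 0)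
    (hu0 : u ≠ 0) (hv0 : v ≠ 0) (h0 : fadd u v ≠ 0) (hne : u * wAt v ≠ v * wAt u) :
    seriesPoint hφ u hu hu0 + seriesPoint hφ v hv hv0 =
      seriesPoint hφ (fadd u v) (constantCoeff_fadd hu hv) h0 := by
  refine curvePoint_add (T := φ (thirdAt u v)) (c := φ (wAt (thirdAt u v)))
    (s := φ (slopeAt u v)) _ _ _ _ _ _ ?_ ?_ ?_ ?_ ?_ ?_ ?_
  · rw [← map_mul, ← map_mul]
    exact fun h => hne (hφ h)
  · simp [thirdAt]
  · rw [← map_sub, ← map_mul, sub_mul_slopeAt hu hv, map_sub]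
  · have := congrArg φ (slope_quadratic hu hv)
    simpa only [map_add, map_mul, map_pow, map_zero] using this
  · rw [wAt_thirdAt hu hv, map_add, map_mul, map_add]
  · have := congrArg φ (fadd_mul_one_add hu hv)
    rwa [map_mul, map_add, map_one] at this
  · have := congrArg φ (wAt_fadd_mul hu hv)
    rwa [map_mul, map_add, map_one] at this

lemma fadd_X_ne_zero {i j : τ} (hij : i ≠ j) :
    fadd (MvPowerSeries.X i : MvPowerSeries τ (ZMod 2)) (MvPowerSeries.X j) ≠ 0 := by
  classical
  intro h
  obtain ⟨q, -, hq⟩ := exists_fadd_eq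
    (u := (MvPowerSeries.X i : MvPowerSeries τ (ZMod 2))) (v := MvPowerSeries.X j)
    (by simp) (by simp)
  have h1 := congrArg (MvPowerSeries.coeff (Finsupp.single i 1)) (hq.symm.trans h)
  rw [map_add, coeff_X_mul, MvPowerSeries.coeff_X, if_pos rfl,
    if_pos (Finsupp.single_eq_of_ne hij.symm), map_zero, add_zero] at h1
  exact one_ne_zero h1

/-- Associativity for three independent variables, where all additions of points on the elliptic
curve that occur are given by the chord construction. -/
lemma fadd_assoc_X :
    fadd (fadd (MvPowerSeries.X 0) (MvPowerSeries.X 1)) (MvPowerSeries.X 2) =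
      fadd (MvPowerSeries.X 0) (fadd (MvPowerSeries.X 1)
        (MvPowerSeries.X 2 : MvPowerSeries (Fin 3) (ZMod 2))) := by
  classical
  set x : MvPowerSeries (Fin 3) (ZMod 2) := MvPowerSeries.X 0 with hx
  set y : MvPowerSeries (Fin 3) (ZMod 2) := MvPowerSeries.X 1 with hy
  set z : MvPowerSeries (Fin 3) (ZMod 2) := MvPowerSeries.X 2 with hz
  have cx : MvPowerSeries.constantCoeff x = 0 := by simp [hx]
  have cy : MvPowerSeries.constantCoeff y = 0 := by simp [hy]
  have cz : MvPowerSeries.constantCoeff z = 0 := by simp [hz]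
  have X0 (i : Fin 3) : (MvPowerSeries.X i : MvPowerSeries (Fin 3) (ZMod 2)) ≠ 0 := by
    intro h
    have := congrArg (MvPowerSeries.coeff (Finsupp.single i 1)) h
    rw [MvPowerSeries.coeff_X, if_pos rfl] at this
    exact one_ne_zero this
  have x0 : x ≠ 0 := X0 _
  have y0 : y ≠ 0 := X0 _
  have z0 : z ≠ 0 := X0 _
  have cxy := constantCoeff_fadd cx cy
  have cyz := constantCoeff_fadd cy cz
  have xy0 : fadd x y ≠ 0 := fadd_X_ne_zero (by decide)
  have yz0 : fadd y z ≠ 0 := fadd_X_ne_zero (by decide)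
  -- the substitutions `z ↦ 0` and `y, z ↦ 0`
  have ca : ∀ i, MvPowerSeries.constantCoeff (![x, y, 0] i) = 0 := by
    intro i; fin_cases i <;> simp [cx, cy]
  have cb : ∀ i, MvPowerSeries.constantCoeff (![x, 0, 0] i) = 0 := by
    intro i; fin_cases i <;> simp [cx]
  have ha := MvPowerSeries.hasSubst_of_constantCoeff_zero ca
  have hb := MvPowerSeries.hasSubst_of_constantCoeff_zero cb
  have ax : x.subst ![x, y, 0] = x := MvPowerSeries.subst_X ha 0
  have ay : y.subst ![x, y, 0] = y := MvPowerSeries.subst_X ha 1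
  have az : z.subst ![x, y, 0] = 0 := MvPowerSeries.subst_X ha 2
  have bx : x.subst ![x, 0, 0] = x := MvPowerSeries.subst_X hb 0
  have bY : y.subst ![x, 0, 0] = 0 := MvPowerSeries.subst_X hb 1
  have bz : z.subst ![x, 0, 0] = 0 := MvPowerSeries.subst_X hb 2
  have axy : (fadd x y).subst ![x, y, 0] = fadd x y := by
    rw [subst_fadd ca ha cx cy, ax, ay]
  have byz : (fadd y z).subst ![x, 0, 0] = 0 := by
    rw [subst_fadd cb hb cy cz, bY, bz, zero_fadd (map_zero _)]
  have n1 : x * wAt y ≠ y * wAt x :=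
    mul_wAt_ne hb cx cy y0 bY (by rwa [bx])
  have n2 : fadd x y * wAt z ≠ z * wAt (fadd x y) :=
    mul_wAt_ne ha cxy cz z0 az (by rwa [axy])
  have n3 : y * wAt z ≠ z * wAt y :=
    mul_wAt_ne ha cy cz z0 az (by rwa [ay])
  have n4 : x * wAt (fadd y z) ≠ fadd y z * wAt x :=
    mul_wAt_ne hb cx cyz yz0 byz (by rwa [bx])
  have m1 : fadd (fadd x y) z ≠ 0 := by
    intro h
    have := congrArg (MvPowerSeries.subst ![x, y, 0]) h
    rw [subst_fadd ca ha cxy cz, axy, az, fadd_comm cxy (map_zero _), zero_fadd cxy,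
      ← MvPowerSeries.coe_substAlgHom ha, map_zero] at this
    exact xy0 this
  have m2 : fadd x (fadd y z) ≠ 0 := by
    intro h
    have := congrArg (MvPowerSeries.subst ![x, 0, 0]) h
    rw [subst_fadd cb hb cx cyz, byz, bx, fadd_comm cx (map_zero _), zero_fadd cx,
      ← MvPowerSeries.coe_substAlgHom hb, map_zero] at this
    exact x0 this
  have : CharP (FractionRing (MvPowerSeries (Fin 3) (ZMod 2))) 2 :=
    CharTwo.of_one_ne_zero_of_two_eq_zero one_ne_zero (two_eq_zero _)
  suffices H : ∀ (K : Type) [Field K] [CharP K 2] (φ : MvPowerSeries (Fin 3) (ZMod 2) →+* K),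
      Function.Injective φ → fadd (fadd x y) z = fadd x (fadd y z) from
    H (FractionRing (MvPowerSeries (Fin 3) (ZMod 2))) (algebraMap _ _)
      (IsFractionRing.injective _ _)
  intro K _ _ φ hφ
  apply seriesPoint_injective hφ (hu := constantCoeff_fadd cxy cz)
    (hv := constantCoeff_fadd cx cyz) (hu0 := m1) (hv0 := m2)
  rw [← seriesPoint_add hφ cxy cz xy0 z0 m1 n2, ← seriesPoint_add hφ cx cy x0 y0 xy0 n1,
    ← seriesPoint_add hφ cx cyz x0 yz0 m2 n4, ← seriesPoint_add hφ cy cz y0 z0 yz0 n3, add_assoc]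

lemma fadd_assoc {R : Type*} [CommRing R] [Algebra (ZMod 2) R] {u v w : MvPowerSeries τ R}
    (hu : MvPowerSeries.constantCoeff u = 0) (hv : MvPowerSeries.constantCoeff v = 0)
    (hw : MvPowerSeries.constantCoeff w = 0) :
    fadd (fadd u v) w = fadd u (fadd v w) := by
  have ca : ∀ i, MvPowerSeries.constantCoeff (![u, v, w] i) = 0 := by
    intro i; fin_cases i <;> simp [hu, hv, hw]
  have ha := MvPowerSeries.hasSubst_of_constantCoeff_zero ca
  have c (i : Fin 3) :
      MvPowerSeries.constantCoeff (MvPowerSeries.X i : MvPowerSeries (Fin 3) (ZMod 2)) = 0 := by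
    simp
  have h := congrArg (MvPowerSeries.subst ![u, v, w]) fadd_assoc_X
  rw [subst_fadd ca ha (constantCoeff_fadd (c 0) (c 1)) (c 2), subst_fadd ca ha (c 0) (c 1),
    subst_fadd ca ha (c 0) (constantCoeff_fadd (c 1) (c 2)), subst_fadd ca ha (c 1) (c 2),
    MvPowerSeries.subst_X ha, MvPowerSeries.subst_X ha, MvPowerSeries.subst_X ha] at h
  exact h

end Associativity

/-! ### The group of points of the formal group -/

section Points

/-- The points of the formal group with values in the ideal of power series without constant
term. They form an abelian group under the formal group law. -/
structure FormalPoint (τ R : Type*) [CommRing R] where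
  /-- The underlying power series. -/
  val : MvPowerSeries τ R
  /-- The constant term vanishes. -/
  property : MvPowerSeries.constantCoeff val = 0

variable {R : Type*} [CommRing R] {τ υ : Type*}

lemma FormalPoint.val_injective :
    Function.Injective (FormalPoint.val : FormalPoint τ R → MvPowerSeries τ R) := by
  rintro ⟨_, _⟩ ⟨_, _⟩ h
  cases h
  rfl

variable [Algebra (ZMod 2) R]

instance : Add (FormalPoint τ R) := ⟨fun p q => ⟨fadd p.1 q.1, constantCoeff_fadd p.2 q.2⟩⟩

instance : Zero (FormalPoint τ R) := ⟨⟨0, map_zero _⟩⟩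

instance : Neg (FormalPoint τ R) := ⟨fun p => ⟨fneg p.1, constantCoeff_fneg p.2⟩⟩

instance : AddCommGroup (FormalPoint τ R) where
  add_assoc p q r := FormalPoint.val_injective (fadd_assoc p.2 q.2 r.2)
  zero_add p := FormalPoint.val_injective (zero_fadd p.2)
  add_zero p := FormalPoint.val_injective ((fadd_comm p.2 (map_zero _)).trans (zero_fadd p.2))
  add_comm p q := FormalPoint.val_injective (fadd_comm p.2 q.2)
  neg_add_cancel p :=
    FormalPoint.val_injective ((fadd_comm (constantCoeff_fneg p.2) p.2).trans (fadd_fneg p.2))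
  nsmul := nsmulRec
  zsmul := zsmulRec

variable {u v w z : MvPowerSeries τ R}

lemma fadd_zero (hu : MvPowerSeries.constantCoeff u = 0) : fadd u 0 = u :=
  congrArg FormalPoint.val (add_zero (⟨u, hu⟩ : FormalPoint τ R))

lemma fadd_fadd_fadd_comm (hu : MvPowerSeries.constantCoeff u = 0)
    (hv : MvPowerSeries.constantCoeff v = 0) (hw : MvPowerSeries.constantCoeff w = 0)
    (hz : MvPowerSeries.constantCoeff z = 0) :
    fadd (fadd u v) (fadd w z) = fadd (fadd u w) (fadd v z) :=
  congrArg FormalPoint.val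
    (add_add_add_comm (⟨u, hu⟩ : FormalPoint τ R) ⟨v, hv⟩ ⟨w, hw⟩ ⟨z, hz⟩)

lemma fneg_unique (hu : MvPowerSeries.constantCoeff u = 0)
    (hv : MvPowerSeries.constantCoeff v = 0) (h : fadd u v = 0) : v = fneg u :=
  congrArg FormalPoint.val (eq_neg_of_add_eq_zero_right
    (show (⟨u, hu⟩ : FormalPoint τ R) + ⟨v, hv⟩ = 0 from FormalPoint.val_injective h))

lemma fneg_injective (hu : MvPowerSeries.constantCoeff u = 0)
    (hv : MvPowerSeries.constantCoeff v = 0) (h : fneg u = fneg v) : u = v :=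
  congrArg FormalPoint.val (neg_injective
    (show -(⟨u, hu⟩ : FormalPoint τ R) = -⟨v, hv⟩ from FormalPoint.val_injective h))

lemma fadd_pow_two_pow (hu : MvPowerSeries.constantCoeff u = 0)
    (hv : MvPowerSeries.constantCoeff v = 0) (n : ℕ) :
    fadd (u ^ 2 ^ n) (v ^ 2 ^ n) = fadd u v ^ 2 ^ n := by
  induction n with
  | zero => simp
  | succ n ih =>
    rw [pow_succ, pow_mul, pow_mul, pow_mul, fadd_sq (by simp [hu]) (by simp [hv]), ih]

lemma subst_fneg {S : Type*} [CommRing S] [Algebra (ZMod 2) S] [Algebra R S]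
    [IsScalarTower (ZMod 2) R S] {a : τ → MvPowerSeries υ S}
    (ha' : ∀ i, MvPowerSeries.constantCoeff (a i) = 0) (ha : MvPowerSeries.HasSubst a)
    (hu : MvPowerSeries.constantCoeff u = 0) : (fneg u).subst a = fneg (u.subst a) := by
  apply fneg_unique (constantCoeff_subst_zero ha' ha hu)
    (constantCoeff_subst_zero ha' ha (constantCoeff_fneg hu))
  rw [← subst_fadd ha' ha hu (constantCoeff_fneg hu), fadd_fneg hu,
    ← MvPowerSeries.coe_substAlgHom ha, map_zero]

end Points

/-! ### Endomorphisms of the formal group -/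

section Composition

variable {R : Type*} [CommRing R] {τ : Type*} {g : R⟦X⟧} {u : MvPowerSeries τ R}

lemma comp_zero (u : MvPowerSeries τ R) (hu : MvPowerSeries.constantCoeff u = 0) :
    PowerSeries.subst u (0 : R⟦X⟧) = 0 := by
  rw [← PowerSeries.coe_substAlgHom (PowerSeries.HasSubst.of_constantCoeff_zero hu), map_zero]

lemma constantCoeff_comp_eq_zero (hg : PowerSeries.constantCoeff g = 0)
    (hu : MvPowerSeries.constantCoeff u = 0) :
    MvPowerSeries.constantCoeff (g.subst u) = 0 :=
  PowerSeries.constantCoeff_subst_eq_zero hu g hg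

lemma comp_C_mul_X_pow (t : R) (n : ℕ) (hu : MvPowerSeries.constantCoeff u = 0) :
    (PowerSeries.C t * PowerSeries.X ^ n : R⟦X⟧).subst u = MvPowerSeries.C t * u ^ n := by
  have h := PowerSeries.HasSubst.of_constantCoeff_zero hu
  rw [PowerSeries.subst_mul h, PowerSeries.subst_pow h, PowerSeries.subst_X h,
    PowerSeries.subst_C]

lemma coeff_one_eq_zero_iff_X_sq_dvd (hg : PowerSeries.constantCoeff g = 0) :
    PowerSeries.coeff 1 g = 0 ↔ PowerSeries.X ^ 2 ∣ g := by
  rw [PowerSeries.X_pow_dvd_iff]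
  refine ⟨fun h1 m hm => ?_, fun h1 => h1 1 one_lt_two⟩
  interval_cases m
  · rwa [PowerSeries.coeff_zero_eq_constantCoeff_apply]
  · exact h1

/-- The decomposition of a power series into an even and an odd part. -/
lemma eq_even_add_odd (h : R⟦X⟧) : h =
    (PowerSeries.mk fun n => PowerSeries.coeff (2 * n) h).subst (PowerSeries.X ^ 2 : R⟦X⟧) +
      PowerSeries.X * (PowerSeries.mk fun n => PowerSeries.coeff (2 * n + 1) h).subst
        (PowerSeries.X ^ 2 : R⟦X⟧) := by
  ext n
  rw [map_add, PowerSeries.coeff_subst_X_pow two_ne_zero]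
  cases n with
  | zero => simp
  | succ n =>
    rw [PowerSeries.coeff_succ_X_mul, PowerSeries.coeff_subst_X_pow two_ne_zero]
    simp only [PowerSeries.coeff_mk, Algebra.algebraMap_self, RingHom.id_apply]
    by_cases hn : 2 ∣ n
    · have hn1 : ¬ 2 ∣ n + 1 := by omega
      rw [if_neg hn1, if_pos hn, zero_add, show 2 * (n / 2) + 1 = n + 1 by omega]
    · have hn1 : 2 ∣ n + 1 := by omega
      rw [if_neg hn, if_pos hn1, add_zero, show 2 * ((n + 1) / 2) = n + 1 by omega]

end Composition

section Endomorphisms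

variable {R : Type*} [CommRing R] [Algebra (ZMod 2) R] {τ : Type*} {g h : R⟦X⟧}
  {u v : MvPowerSeries τ R}

lemma comp_fadd (hg : PowerSeries.constantCoeff g = 0) (hh : PowerSeries.constantCoeff h = 0)
    (hu : MvPowerSeries.constantCoeff u = 0) :
    PowerSeries.subst u (fadd g h) = fadd (g.subst u) (h.subst u) :=
  subst_fadd (fun _ => hu) (PowerSeries.HasSubst.of_constantCoeff_zero hu).const hg hh

lemma comp_fneg (hg : PowerSeries.constantCoeff g = 0)
    (hu : MvPowerSeries.constantCoeff u = 0) :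
    PowerSeries.subst u (fneg g) = fneg (g.subst u) :=
  subst_fneg (fun _ => hu) (PowerSeries.HasSubst.of_constantCoeff_zero hu).const hg

/-- An endomorphism of the formal group: a power series without constant term that is compatible
with the addition of the two generic points. -/
structure IsFormalEnd (g : R⟦X⟧) : Prop where
  constantCoeff_eq_zero : PowerSeries.constantCoeff g = 0
  comp_fadd_X : g.subst (fadd (MvPowerSeries.X 0 : MvPowerSeries (Fin 2) R) (MvPowerSeries.X 1)) =
    fadd (g.subst (MvPowerSeries.X 0 : MvPowerSeries (Fin 2) R))
      (g.subst (MvPowerSeries.X 1 : MvPowerSeries (Fin 2) R))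

lemma fadd_X : fadd (MvPowerSeries.X 0 : MvPowerSeries (Fin 2) R) (MvPowerSeries.X 1) = fgl R := by
  have e : ![(MvPowerSeries.X 0 : MvPowerSeries (Fin 2) R), MvPowerSeries.X 1] =
      MvPowerSeries.X := by
    funext i
    fin_cases i <;> rfl
  rw [fadd, e]
  exact congrFun MvPowerSeries.subst_self (fgl R)

lemma fadd_comp_X (g : R⟦X⟧) : fadd (g.subst (MvPowerSeries.X 0 : MvPowerSeries (Fin 2) R))
    (g.subst (MvPowerSeries.X 1 : MvPowerSeries (Fin 2) R)) = (fgl R).subst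
      (fun i : Fin 2 => g.subst (MvPowerSeries.X i : MvPowerSeries (Fin 2) R)) := by
  rw [fadd]
  congr 1
  funext i
  fin_cases i <;> rfl

lemma IsFormalAut.isFormalEnd (hg : IsFormalAut g) : IsFormalEnd g where
  constantCoeff_eq_zero := hg.1
  comp_fadd_X := by rw [fadd_X, fadd_comp_X, hg.hom]

lemma IsFormalEnd.isFormalAut (hg : IsFormalEnd g) (h1 : IsUnit (PowerSeries.coeff 1 g)) :
    IsFormalAut g where
  constantCoeff_eq_zero := hg.1
  isUnit_coeff_one := h1
  hom := by rw [← fadd_comp_X, ← fadd_X, hg.comp_fadd_X]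

/-- An endomorphism preserves the addition of arbitrary points. -/
lemma IsFormalEnd.map_fadd (hg : IsFormalEnd g) (hu : MvPowerSeries.constantCoeff u = 0)
    (hv : MvPowerSeries.constantCoeff v = 0) :
    g.subst (fadd u v) = fadd (g.subst u) (g.subst v) := by
  have ha : ∀ i, MvPowerSeries.constantCoeff (![u, v] i) = 0 := by
    intro i; fin_cases i <;> simp [hu, hv]
  have hp := hasSubst_vec hu hv
  have c (i : Fin 2) :
      MvPowerSeries.constantCoeff (MvPowerSeries.X i : MvPowerSeries (Fin 2) R) = 0 := by simp
  have e {x : MvPowerSeries (Fin 2) R} (hx : MvPowerSeries.constantCoeff x = 0) :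
      (g.subst x).subst ![u, v] = g.subst (x.subst ![u, v]) := by
    rw [PowerSeries.subst, MvPowerSeries.subst_comp_subst_apply
      (PowerSeries.HasSubst.of_constantCoeff_zero hx).const hp]
    rfl
  have h1 := congrArg (MvPowerSeries.subst ![u, v]) hg.comp_fadd_X
  rw [e (constantCoeff_fadd (c 0) (c 1)), subst_fadd ha hp (c 0) (c 1),
    subst_fadd ha hp (constantCoeff_subst_X hg.1 0) (constantCoeff_subst_X hg.1 1),
    e (c 0), e (c 1), MvPowerSeries.subst_X hp, MvPowerSeries.subst_X hp] at h1
  exact h1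

lemma isFormalEnd_zero : IsFormalEnd (0 : R⟦X⟧) where
  constantCoeff_eq_zero := map_zero _
  comp_fadd_X := by
    rw [comp_zero _ (constantCoeff_fadd (by simp) (by simp)), comp_zero _ (by simp),
      comp_zero _ (by simp), zero_fadd (map_zero _)]

/-- Since the formal group is commutative, sums of endomorphisms are endomorphisms. -/
lemma IsFormalEnd.add (hg : IsFormalEnd g) (hh : IsFormalEnd h) :
    IsFormalEnd (fadd g h : R⟦X⟧) where
  constantCoeff_eq_zero := constantCoeff_fadd hg.1 hh.1
  comp_fadd_X := by
    have c (i : Fin 2) :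
        MvPowerSeries.constantCoeff (MvPowerSeries.X i : MvPowerSeries (Fin 2) R) = 0 := by simp
    rw [comp_fadd hg.1 hh.1 (constantCoeff_fadd (c 0) (c 1)),
      comp_fadd hg.1 hh.1 (c 0), comp_fadd hg.1 hh.1 (c 1),
      hg.comp_fadd_X, hh.comp_fadd_X]
    exact fadd_fadd_fadd_comm (constantCoeff_subst_X hg.1 0) (constantCoeff_subst_X hg.1 1)
      (constantCoeff_subst_X hh.1 0) (constantCoeff_subst_X hh.1 1)

lemma IsFormalEnd.map_fneg (hg : IsFormalEnd g) (hu : MvPowerSeries.constantCoeff u = 0) :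
    g.subst (fneg u) = fneg (g.subst u) := by
  have hn := constantCoeff_fneg hu
  apply fneg_unique (constantCoeff_comp_eq_zero hg.1 hu) (constantCoeff_comp_eq_zero hg.1 hn)
  rw [← hg.map_fadd hu hn, fadd_fneg hu]
  exact PowerSeries.subst_zero_of_constantCoeff_zero hg.1

lemma IsFormalEnd.neg (hg : IsFormalEnd g) : IsFormalEnd (fneg g : R⟦X⟧) where
  constantCoeff_eq_zero := constantCoeff_fneg hg.1
  comp_fadd_X := by
    have c (i : Fin 2) :
        MvPowerSeries.constantCoeff (MvPowerSeries.X i : MvPowerSeries (Fin 2) R) = 0 := by simp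
    rw [comp_fneg hg.1 (constantCoeff_fadd (c 0) (c 1)),
      comp_fneg hg.1 (c 0), comp_fneg hg.1 (c 1), hg.comp_fadd_X]
    exact congrArg FormalPoint.val (neg_add
      (⟨_, constantCoeff_subst_X hg.1 0⟩ : FormalPoint (Fin 2) R)
      ⟨_, constantCoeff_subst_X hg.1 1⟩)

/-- If `t⁴ = t`, then `t z^(2^n)` is an endomorphism of the formal group. -/
lemma isFormalEnd_C_mul_X_pow {t : R} (ht : t ^ 4 = t) (n : ℕ) :
    IsFormalEnd (PowerSeries.C t * PowerSeries.X ^ 2 ^ n : R⟦X⟧) where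
  constantCoeff_eq_zero := by simp
  comp_fadd_X := by
    have c (i : Fin 2) :
        MvPowerSeries.constantCoeff (MvPowerSeries.X i : MvPowerSeries (Fin 2) R) = 0 := by simp
    rw [comp_C_mul_X_pow _ _ (constantCoeff_fadd (c 0) (c 1)), comp_C_mul_X_pow _ _ (c 0),
      comp_C_mul_X_pow _ _ (c 1), fadd_mul_left (by rw [← map_pow, ht]) (by simp) (by simp),
      fadd_pow_two_pow (c 0) (c 1)]

/-- Multiplication by `-2` on the formal group is `z ↦ z⁴`, so endomorphisms commute with the
fourth power. -/
lemma IsFormalEnd.comp_X_pow_four (hg : IsFormalEnd g) :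
    g.subst (PowerSeries.X ^ 4 : R⟦X⟧) = g ^ 4 := by
  have hX : PowerSeries.constantCoeff (PowerSeries.X : R⟦X⟧) = 0 := by simp
  have hX4 : PowerSeries.constantCoeff (PowerSeries.X ^ 4 : R⟦X⟧) = 0 := by simp
  have h := hg.map_fadd hX hX
  rw [fadd_self hX, PowerSeries.X_subst, fadd_self hg.1, hg.map_fneg hX4] at h
  refine fneg_injective (constantCoeff_comp_eq_zero hg.1 hX4) ?_ h
  have := hg.1
  change PowerSeries.constantCoeff (g ^ 4) = 0
  simp [this]

lemma IsFormalEnd.coeff_one_pow_four (hg : IsFormalEnd g) :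
    PowerSeries.coeff 1 g ^ 4 = PowerSeries.coeff 1 g := by
  have h := congrArg (PowerSeries.coeff 4) hg.comp_X_pow_four
  rw [PowerSeries.coeff_subst_X_pow (by norm_num)] at h
  obtain ⟨q, rfl⟩ := PowerSeries.X_dvd_iff.mpr hg.1
  rw [mul_pow, PowerSeries.coeff_X_pow_mul', if_pos le_rfl] at h
  have e : PowerSeries.coeff 1 (PowerSeries.X * q) = PowerSeries.constantCoeff q := by
    rw [show (1 : ℕ) = 0 + 1 from rfl, PowerSeries.coeff_succ_X_mul,
      PowerSeries.coeff_zero_eq_constantCoeff_apply]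
  simp only [Nat.sub_self, PowerSeries.coeff_zero_eq_constantCoeff_apply, map_pow] at h
  rw [e, ← h]
  simp

/-- An endomorphism with vanishing derivative at `0` factors through Frobenius. Comparing
coefficients of `y` in `h(F(x, y)) = F(h(x), h(y))` shows that the derivative of `h` vanishes
everywhere, that is, the odd part of `h` is zero. -/
lemma IsFormalEnd.exists_eq_comp_sq (hh : IsFormalEnd h) (h1 : PowerSeries.coeff 1 h = 0) :
    ∃ a : R⟦X⟧, IsFormalEnd a ∧ h = a.subst (PowerSeries.X ^ 2 : R⟦X⟧) := by
  have h2 := two_eq_zero (MvPowerSeries (Fin 2) R)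
  obtain ⟨k, hk⟩ := (coeff_one_eq_zero_iff_X_sq_dvd hh.1).mp h1
  set a : R⟦X⟧ := PowerSeries.mk fun n => PowerSeries.coeff (2 * n) h with ha
  set b : R⟦X⟧ := PowerSeries.mk fun n => PowerSeries.coeff (2 * n + 1) h with hb
  have hab := eq_even_add_odd h
  rw [← ha, ← hb] at hab
  have ha0 : PowerSeries.constantCoeff a = 0 := by
    rw [← PowerSeries.coeff_zero_eq_constantCoeff_apply, ha, PowerSeries.coeff_mk, mul_zero,
      PowerSeries.coeff_zero_eq_constantCoeff_apply, hh.1]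
  have hcomp {τ : Type} (c : R⟦X⟧) {u : MvPowerSeries τ R}
      (hu : MvPowerSeries.constantCoeff u = 0) :
      PowerSeries.subst u (c.subst (PowerSeries.X ^ 2 : R⟦X⟧)) = c.subst (u ^ 2) := by
    have := PowerSeries.HasSubst.of_constantCoeff_zero hu
    rw [comp_assoc (by simp) hu, PowerSeries.subst_pow this, PowerSeries.subst_X this]
  have heval {τ : Type} {u : MvPowerSeries τ R} (hu : MvPowerSeries.constantCoeff u = 0) :
      h.subst u = a.subst (u ^ 2) + u * b.subst (u ^ 2) := by
    have := PowerSeries.HasSubst.of_constantCoeff_zero hu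
    conv_lhs => rw [hab]
    rw [PowerSeries.subst_add this, PowerSeries.subst_mul this, PowerSeries.subst_X this,
      hcomp a hu, hcomp b hu]
  set x : MvPowerSeries (Fin 2) R := MvPowerSeries.X 0 with hx
  set y : MvPowerSeries (Fin 2) R := MvPowerSeries.X 1 with hy
  have cx : MvPowerSeries.constantCoeff x = 0 := by simp [hx]
  have cy : MvPowerSeries.constantCoeff y = 0 := by simp [hy]
  have cx2 : MvPowerSeries.constantCoeff (x ^ 2) = 0 := by simp [hx]
  have cf := constantCoeff_fadd cx cy
  have cf2 : MvPowerSeries.constantCoeff (fadd x y ^ 2) = 0 := by simp [cf]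
  have hb0 : b = 0 := by
    obtain ⟨q, hq, hf⟩ := exists_fadd_eq cx cy
    obtain ⟨q', -, hf'⟩ := exists_fadd_eq (constantCoeff_comp_eq_zero hh.1 cx)
      (constantCoeff_comp_eq_zero hh.1 cy)
    have hky : h.subst y = y ^ 2 * k.subst y := by
      have := PowerSeries.HasSubst.of_constantCoeff_zero cy
      conv_lhs => rw [hk]
      rw [PowerSeries.subst_mul this, PowerSeries.subst_pow this, PowerSeries.subst_X this]
    have hmain := hh.map_fadd cx cy
    obtain ⟨ra, hra⟩ := subst_sub_dvd cx2 cf2 a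
    obtain ⟨rb, hrb⟩ := subst_sub_dvd cx2 cf2 b
    rw [hf', hky, heval cf, heval cx] at hmain
    have hfsq : fadd x y ^ 2 - x ^ 2 = y ^ 2 * q ^ 2 := by
      rw [hf]
      linear_combination x * y * q * h2
    rw [hfsq] at hra hrb
    -- Modulo `y²`, the series `h(F(x, y))` is `h(x) + y q b(x²)`.
    have hy1 : y * (q * b.subst (x ^ 2)) = y * (y * (k.subst y * q' - q ^ 2 * ra -
        (x + y * q) * q ^ 2 * rb)) := by
      rw [hf] at hmain hra hrb
      linear_combination hmain - hra - (x + y * q) * hrb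
    have hy2 : q * b.subst (x ^ 2) = y * (k.subst y * q' - q ^ 2 * ra -
        (x + y * q) * q ^ 2 * rb) := by
      have := (MvPowerSeries.X_mem_nonzeroDivisors (R := R) (i := (1 : Fin 2)))
      exact mul_cancel_left_mem_nonZeroDivisors this |>.mp hy1
    have hqu : IsUnit q := by
      rw [MvPowerSeries.isUnit_iff_constantCoeff, hq]
      exact isUnit_one
    -- Substituting `y = 0`
    have cX : PowerSeries.constantCoeff (PowerSeries.X : R⟦X⟧) = 0 := by simp
    have hs : MvPowerSeries.HasSubst ![(PowerSeries.X : R⟦X⟧), 0] :=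
      hasSubst_vec cX (map_zero _)
    have hy3 := congrArg (MvPowerSeries.substAlgHom (S := R) hs) hy2
    rw [map_mul, map_mul, hy, MvPowerSeries.substAlgHom_X] at hy3
    simp only [Matrix.cons_val_one, Matrix.cons_val_fin_one, zero_mul] at hy3
    have hy4 := (hqu.map (MvPowerSeries.substAlgHom (S := R) hs)).mul_right_eq_zero.mp hy3
    have hbx : MvPowerSeries.subst ![(PowerSeries.X : R⟦X⟧), 0] (b.subst (x ^ 2)) =
        b.subst (PowerSeries.X ^ 2 : R⟦X⟧) := by
      rw [PowerSeries.subst, MvPowerSeries.subst_comp_subst_apply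
        (PowerSeries.HasSubst.of_constantCoeff_zero cx2).const hs, PowerSeries.subst]
      congr 1
      funext _
      rw [MvPowerSeries.subst_pow hs, hx, MvPowerSeries.subst_X hs]
      rfl
    rw [MvPowerSeries.coe_substAlgHom, hbx] at hy4
    ext n
    have := congrArg (PowerSeries.coeff (2 * n)) hy4
    rw [PowerSeries.coeff_subst_X_pow two_ne_zero, if_pos (dvd_mul_right 2 n),
      Nat.mul_div_cancel_left n two_pos] at this
    simpa using this
  have haX : h = a.subst (PowerSeries.X ^ 2 : R⟦X⟧) := by
    conv_lhs => rw [hab, hb0]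
    rw [comp_zero _ (show PowerSeries.constantCoeff (PowerSeries.X ^ 2 : R⟦X⟧) = 0 by simp),
      mul_zero, add_zero]
  refine ⟨a, ⟨ha0, ?_⟩, haX⟩
  have hainj : Function.Injective (MvPowerSeries.expand (σ := Fin 2) (R := R) 2 two_ne_zero) := by
    intro f g hfg
    ext m
    have := congrArg (MvPowerSeries.coeff (2 • m)) hfg
    rwa [MvPowerSeries.coeff_expand_smul, MvPowerSeries.coeff_expand_smul] at this
  have hsq : ∀ i, MvPowerSeries.constantCoeff
      ((MvPowerSeries.X i : MvPowerSeries (Fin 2) R) ^ 2) = 0 := by simp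
  have hsq' := MvPowerSeries.hasSubst_of_constantCoeff_zero hsq
  have hexp (f : MvPowerSeries (Fin 2) R) : MvPowerSeries.expand 2 two_ne_zero f =
      f.subst fun i => (MvPowerSeries.X i : MvPowerSeries (Fin 2) R) ^ 2 := by
    rw [MvPowerSeries.expand, MvPowerSeries.coe_substAlgHom]
  have hexpa {u : MvPowerSeries (Fin 2) R} (hu : MvPowerSeries.constantCoeff u = 0) :
      (a.subst u).subst (fun i => (MvPowerSeries.X i : MvPowerSeries (Fin 2) R) ^ 2) =
      a.subst (u.subst fun i => (MvPowerSeries.X i : MvPowerSeries (Fin 2) R) ^ 2) := by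
    rw [PowerSeries.subst, MvPowerSeries.subst_comp_subst_apply
      (PowerSeries.HasSubst.of_constantCoeff_zero hu).const hsq']
    rfl
  apply hainj
  have hmain := hh.map_fadd cx cy
  rw [haX, hcomp a cf, hcomp a cx, hcomp a cy, ← fadd_sq cx cy] at hmain
  rw [hexp, hexp, hexpa cf, subst_fadd hsq hsq' cx cy,
    subst_fadd hsq hsq' (constantCoeff_comp_eq_zero ha0 cx) (constantCoeff_comp_eq_zero ha0 cy),
    hexpa cx, hexpa cy, MvPowerSeries.subst_X hsq', MvPowerSeries.subst_X hsq', hmain]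

end Endomorphisms

/-! ### Formal sums -/

section FormalSums

lemma constantCoeff_C_mul_X_pow {R : Type*} [CommRing R] (t : R) (n : ℕ) :
    PowerSeries.constantCoeff (PowerSeries.C t * PowerSeries.X ^ 2 ^ n : R⟦X⟧) = 0 := by
  simp

variable {R : Type*} [CommRing R] [Algebra (ZMod 2) R] {g : R⟦X⟧}

lemma formalPartialSum_succ (t : ℕ → R) (n : ℕ) : formalPartialSum t (n + 1) =
    fadd (formalPartialSum t n) (PowerSeries.C (t n) * PowerSeries.X ^ 2 ^ n : R⟦X⟧) := rfl

lemma constantCoeff_formalPartialSum (t : ℕ → R) (n : ℕ) :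
    PowerSeries.constantCoeff (formalPartialSum t n) = 0 := by
  induction n with
  | zero => exact map_zero _
  | succ n ih => exact constantCoeff_fadd ih (constantCoeff_C_mul_X_pow _ _)

lemma formalPartialSum_congr {t t' : ℕ → R} {n : ℕ} (h : ∀ i < n, t i = t' i) :
    formalPartialSum t n = formalPartialSum t' n := by
  induction n with
  | zero => rfl
  | succ n ih =>
    rw [formalPartialSum_succ, formalPartialSum_succ, ih fun i hi => h i (hi.trans n.lt_succ_self),
      h n n.lt_succ_self]

/-- Base change of partial sums. -/
lemma map_formalPartialSum {S : Type*} [CommRing S] [Algebra (ZMod 2) S] (φ : R →ₐ[ZMod 2] S)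
    (t : ℕ → R) (n : ℕ) :
    PowerSeries.map (φ : R →+* S) (formalPartialSum t n) =
      formalPartialSum (fun i => φ (t i)) n := by
  induction n with
  | zero => exact map_zero _
  | succ n ih =>
    have h := hasSubst_vec (constantCoeff_formalPartialSum t n)
      (constantCoeff_C_mul_X_pow (t n) n)
    rw [formalPartialSum_succ, formalPartialSum_succ, ← ih, fadd, fadd]
    refine (MvPowerSeries.map_subst h (h := (φ : R →+* S)) (fgl R)).trans ?_
    rw [map_fgl]
    congr 1
    funext i
    fin_cases i
    · rfl
    · change PowerSeries.map (φ : R →+* S) _ = _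
      simp

lemma isFormalEnd_formalPartialSum {t : ℕ → R} (ht : ∀ i, t i ^ 4 = t i) (n : ℕ) :
    IsFormalEnd (formalPartialSum t n) := by
  induction n with
  | zero => exact isFormalEnd_zero
  | succ n ih => exact ih.add (isFormalEnd_C_mul_X_pow (ht n) n)

/-- Adding a multiple of `z^N` does not change the coefficients below degree `N`. -/
lemma X_pow_dvd_fadd_sub {u v : R⟦X⟧} (hu : PowerSeries.constantCoeff u = 0)
    (hv : PowerSeries.constantCoeff v = 0) {N : ℕ} (h : PowerSeries.X ^ N ∣ v) :
    PowerSeries.X ^ N ∣ (fadd u v : R⟦X⟧) - u := by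
  obtain ⟨q, -, hq⟩ := exists_fadd_eq (R := R) (τ := Unit) hu hv
  rw [hq]
  refine h.trans ⟨q, ?_⟩
  exact add_sub_cancel_left u (v * q)

/-- Adding `t z^N` adds `t` to the coefficient of degree `N`. -/
lemma coeff_fadd_C_mul_X_pow {u : R⟦X⟧} (hu : PowerSeries.constantCoeff u = 0) (t : R) {N : ℕ}
    (hN : N ≠ 0) :
    PowerSeries.coeff N (fadd u (PowerSeries.C t * PowerSeries.X ^ N) : R⟦X⟧) =
      PowerSeries.coeff N u + t := by
  have hv : PowerSeries.constantCoeff (PowerSeries.C t * PowerSeries.X ^ N : R⟦X⟧) = 0 := by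
    simp [hN]
  obtain ⟨q, hq1, hq⟩ := exists_fadd_eq (R := R) (τ := Unit) hu hv
  rw [hq]
  refine (map_add (PowerSeries.coeff N) u (PowerSeries.C t * PowerSeries.X ^ N * q)).trans ?_
  congr 1
  have hq1' : PowerSeries.constantCoeff q = 1 := hq1
  rw [mul_assoc, PowerSeries.coeff_C_mul, PowerSeries.coeff_X_pow_mul', if_pos le_rfl,
    Nat.sub_self, PowerSeries.coeff_zero_eq_constantCoeff_apply, hq1', mul_one]

lemma X_pow_dvd_formalPartialSum_sub (t : ℕ → R) {m n : ℕ} (hmn : m ≤ n) :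
    PowerSeries.X ^ 2 ^ m ∣ formalPartialSum t n - formalPartialSum t m := by
  induction n, hmn using Nat.le_induction with
  | base => simp
  | succ n hmn ih =>
    have h : (PowerSeries.X ^ 2 ^ m : R⟦X⟧) ∣
        formalPartialSum t (n + 1) - formalPartialSum t n :=
      X_pow_dvd_fadd_sub (constantCoeff_formalPartialSum t n) (constantCoeff_C_mul_X_pow _ _)
        ((pow_dvd_pow _ (Nat.pow_le_pow_right two_pos hmn)).mul_left _)
    have := dvd_add h ih
    rwa [sub_add_sub_cancel] at this

/-- A finite partial sum is the infinite formal sum of the truncated sequence. -/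
lemma isFormalSum_truncate (t : ℕ → R) (n : ℕ) :
    IsFormalSum (fun i => if i < n then t i else 0) (formalPartialSum t n) := by
  intro m
  have h0 : ∀ k ≥ n, formalPartialSum (fun i => if i < n then t i else 0) k =
      formalPartialSum t n := by
    intro k hk
    induction k, hk using Nat.le_induction with
    | base => exact formalPartialSum_congr fun i hi => if_pos hi
    | succ k hk ih =>
      rw [formalPartialSum_succ, ih, if_neg (not_lt.mpr hk), map_zero, zero_mul]
      exact fadd_zero (constantCoeff_formalPartialSum t n)
  rcases le_total m n with hmn | hnm
  · rw [formalPartialSum_congr (n := m) (t' := t) fun i hi => if_pos (hi.trans_le hmn)]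
    exact X_pow_dvd_formalPartialSum_sub t hmn
  · rw [h0 m hnm, sub_self]
    exact dvd_zero _

lemma IsFormalSum.map {S : Type*} [CommRing S] [Algebra (ZMod 2) S] {t : ℕ → R}
    (h : IsFormalSum t g) (φ : R →ₐ[ZMod 2] S) :
    IsFormalSum (fun i => φ (t i)) (PowerSeries.map (φ : R →+* S) g) := by
  intro n
  have := map_dvd (PowerSeries.map (φ : R →+* S)) (h n)
  rwa [map_pow, PowerSeries.map_X, map_sub, map_formalPartialSum] at this

/-- The coefficients of a formal sum are uniquely determined. -/
lemma IsFormalSum.unique {t t' : ℕ → R} (h : IsFormalSum t g) (h' : IsFormalSum t' g) (n : ℕ) :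
    t n = t' n := by
  induction n using Nat.strong_induction_on with
  | _ n ih =>
    have e := PowerSeries.X_pow_dvd_iff.mp (dvd_sub (h' (n + 1)) (h (n + 1))) (2 ^ n)
      (Nat.pow_lt_pow_right one_lt_two n.lt_succ_self)
    have hN : 2 ^ n ≠ 0 := pow_ne_zero _ two_ne_zero
    rw [sub_sub_sub_cancel_left, map_sub, formalPartialSum_succ, formalPartialSum_succ,
      coeff_fadd_C_mul_X_pow (constantCoeff_formalPartialSum t n) _ hN,
      coeff_fadd_C_mul_X_pow (constantCoeff_formalPartialSum t' n) _ hN,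
      formalPartialSum_congr ih, add_sub_add_left_eq_sub, sub_eq_zero] at e
    exact e

lemma IsFormalSum.coeff_one {t : ℕ → R} (h : IsFormalSum t g) : PowerSeries.coeff 1 g = t 0 := by
  have e := PowerSeries.X_pow_dvd_iff.mp (h 1) 1 (by norm_num)
  have := coeff_fadd_C_mul_X_pow (u := (0 : R⟦X⟧)) (map_zero _) (t 0) (N := 1) one_ne_zero
  rw [map_zero, zero_add] at this
  rw [map_sub, sub_eq_zero] at e
  exact e.trans this

/-- One step of the decomposition of an endomorphism: split off `t z` and divide by Frobenius. -/
lemma IsFormalEnd.exists_eq_fadd (hg : IsFormalEnd g) : ∃ g' : R⟦X⟧, IsFormalEnd g' ∧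
    g = fadd (PowerSeries.C (PowerSeries.coeff 1 g) * PowerSeries.X : R⟦X⟧)
      (g'.subst (PowerSeries.X ^ 2 : R⟦X⟧)) := by
  set t := PowerSeries.coeff 1 g with ht
  have hl : IsFormalEnd (PowerSeries.C t * PowerSeries.X : R⟦X⟧) := by
    have := isFormalEnd_C_mul_X_pow hg.coeff_one_pow_four 0
    rwa [pow_zero, pow_one] at this
  have hh := hg.add hl.neg
  have hsum : fadd (fadd g (fneg (PowerSeries.C t * PowerSeries.X)) : R⟦X⟧)
      (PowerSeries.C t * PowerSeries.X) = g :=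
    congrArg FormalPoint.val (neg_add_cancel_right (⟨g, hg.1⟩ : FormalPoint Unit R) ⟨_, hl.1⟩)
  have h1 : PowerSeries.coeff 1
      (fadd g (fneg (PowerSeries.C t * PowerSeries.X)) : R⟦X⟧) = 0 := by
    have := coeff_fadd_C_mul_X_pow hh.1 t (N := 1) one_ne_zero
    rw [pow_one, hsum, ← ht] at this
    exact left_eq_add.mp (this.trans (add_comm _ _))
  obtain ⟨a, ha, hha⟩ := hh.exists_eq_comp_sq h1
  refine ⟨a, ha, ?_⟩
  rw [← hha]
  exact hsum.symm.trans (fadd_comm hh.1 hl.1)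

/-- Every endomorphism of the formal group is a formal sum `∑ t_i z^(2^i)` with `t_i⁴ = t_i`. -/
lemma IsFormalEnd.exists_isFormalSum (hg : IsFormalEnd g) :
    ∃ t : ℕ → R, (∀ i, t i ^ 4 = t i) ∧ IsFormalSum t g := by
  choose next hnext hnext' using fun f : {f : R⟦X⟧ // IsFormalEnd f} => f.2.exists_eq_fadd
  let G : ℕ → {f : R⟦X⟧ // IsFormalEnd f} := fun n =>
    Nat.rec ⟨g, hg⟩ (fun _ f => ⟨next f, hnext f⟩) n
  have hG (n : ℕ) : (G (n + 1)).1 = next (G n) := rfl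
  have hX (n : ℕ) : PowerSeries.constantCoeff (PowerSeries.X ^ 2 ^ n : R⟦X⟧) = 0 := by simp
  have hGX (n : ℕ) : PowerSeries.constantCoeff
      ((G n).1.subst (PowerSeries.X ^ 2 ^ n : R⟦X⟧)) = 0 :=
    constantCoeff_comp_eq_zero (G n).2.1 (hX n)
  set t : ℕ → R := fun n => PowerSeries.coeff 1 (G n).1 with ht
  have key (n : ℕ) :
      g = fadd (formalPartialSum t n) ((G n).1.subst (PowerSeries.X ^ 2 ^ n : R⟦X⟧)) := by
    induction n with
    | zero =>
      rw [pow_zero, pow_one, PowerSeries.X_subst]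
      exact (zero_fadd hg.1).symm
    | succ n ih =>
      have hsub := PowerSeries.HasSubst.of_constantCoeff_zero' (hX n)
      have e : (G n).1.subst (PowerSeries.X ^ 2 ^ n : R⟦X⟧) =
          fadd (PowerSeries.C (t n) * PowerSeries.X ^ 2 ^ n : R⟦X⟧)
            ((G (n + 1)).1.subst (PowerSeries.X ^ 2 ^ (n + 1) : R⟦X⟧)) := by
        have hc1 : PowerSeries.constantCoeff (PowerSeries.C (t n) * PowerSeries.X : R⟦X⟧) = 0 := by
          simp
        have hX2 : PowerSeries.constantCoeff (PowerSeries.X ^ 2 : R⟦X⟧) = 0 := hX 1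
        conv_lhs => rw [hnext' (G n)]
        rw [comp_fadd hc1 (constantCoeff_comp_eq_zero (hnext (G n)).1 hX2) (hX n),
          comp_assoc hX2 (hX n), PowerSeries.subst_mul hsub, PowerSeries.subst_pow hsub,
          PowerSeries.subst_X hsub, PowerSeries.subst_C, ← hG, ← pow_mul, ← pow_succ]
        rfl
      rw [formalPartialSum_succ, fadd_assoc (constantCoeff_formalPartialSum t n)
        (constantCoeff_C_mul_X_pow _ _) (hGX (n + 1)), ← e]
      exact ih
  refine ⟨t, fun i => (G i).2.coeff_one_pow_four, fun n => ?_⟩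
  have hdvd : PowerSeries.X ^ 2 ^ n ∣ (G n).1.subst (PowerSeries.X ^ 2 ^ n : R⟦X⟧) := by
    have hsub := PowerSeries.HasSubst.of_constantCoeff_zero' (hX n)
    obtain ⟨q, hq⟩ := PowerSeries.X_dvd_iff.mpr (G n).2.1
    rw [hq, PowerSeries.subst_mul hsub, PowerSeries.subst_X hsub]
    exact dvd_mul_right _ _
  have := X_pow_dvd_fadd_sub (constantCoeff_formalPartialSum t n) (hGX n) hdvd
  rwa [← key n] at this

end FormalSums

/-! ### The presentation of `Σ` -/

section Presentation

lemma tGen_zero_pow_three : tGen 0 ^ 3 = 1 := by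
  rw [tGen, ← map_pow, ← map_one (Ideal.Quotient.mk _), Ideal.Quotient.mk_eq_mk_iff_sub_mem]
  exact Ideal.subset_span (Or.inl rfl)

lemma tGen_pow_four (i : ℕ) : tGen i ^ 4 = tGen i := by
  cases i with
  | zero => rw [pow_succ, tGen_zero_pow_three, one_mul]
  | succ i =>
    rw [tGen, ← map_pow, Ideal.Quotient.mk_eq_mk_iff_sub_mem]
    exact Ideal.subset_span (Or.inr ⟨i, rfl⟩)

variable {R : Type*} [CommRing R] [Algebra (ZMod 2) R]

/-- The algebra homomorphism out of the presentation that is given by a solution of the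
relations. -/
def presentationLift (t : ℕ → R) (h0 : t 0 ^ 3 = 1) (h : ∀ i, t (i + 1) ^ 4 = t (i + 1)) :
    SigmaPresentation →ₐ[ZMod 2] R :=
  Ideal.Quotient.liftₐ _ (MvPolynomial.aeval t) (by
    suffices H : Ideal.span ({MvPolynomial.X 0 ^ 3 - 1} ∪ Set.range fun i : ℕ =>
        (MvPolynomial.X (i + 1) ^ 4 - MvPolynomial.X (i + 1) : MvPolynomial ℕ (ZMod 2))) ≤
        RingHom.ker (MvPolynomial.aeval t : MvPolynomial ℕ (ZMod 2) →ₐ[ZMod 2] R) from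
      fun a ha => H ha
    refine Ideal.span_le.mpr ?_
    rintro p (rfl | ⟨i, rfl⟩)
    · simp [RingHom.mem_ker, h0]
    · simp [RingHom.mem_ker, h i])

lemma presentationLift_tGen (t : ℕ → R) (h0 : t 0 ^ 3 = 1)
    (h : ∀ i, t (i + 1) ^ 4 = t (i + 1)) (i : ℕ) : presentationLift t h0 h (tGen i) = t i :=
  MvPolynomial.aeval_X t i

lemma presentation_hom_ext {φ ψ : SigmaPresentation →ₐ[ZMod 2] R}
    (h : ∀ i, φ (tGen i) = ψ (tGen i)) : φ = ψ := by
  apply Ideal.Quotient.algHom_ext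
  exact MvPolynomial.algHom_ext h

/-- The endomorphism of the presentation that keeps `t_i` for `i ≤ n` and kills the other
generators. -/
def truncateGens (n : ℕ) : SigmaPresentation →ₐ[ZMod 2] SigmaPresentation :=
  presentationLift (fun i => if i < n + 1 then tGen i else 0)
    (by simp [tGen_zero_pow_three]) (by intro i; split_ifs <;> simp [tGen_pow_four])

lemma truncateGens_tGen (n i : ℕ) :
    truncateGens n (tGen i) = if i < n + 1 then tGen i else 0 :=
  presentationLift_tGen _ _ _ i

lemma exists_truncateGens_eq (p : SigmaPresentation) : ∃ n, truncateGens n p = p := by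
  suffices H : ∃ n, ∀ m ≥ n, truncateGens m p = p by
    obtain ⟨n, hn⟩ := H
    exact ⟨n, hn n le_rfl⟩
  obtain ⟨p, rfl⟩ := Ideal.Quotient.mk_surjective p
  induction p using MvPolynomial.induction_on with
  | C a => exact ⟨0, fun m _ => (truncateGens m).commutes a⟩
  | add p q hp hq =>
    obtain ⟨m, hm⟩ := hp
    obtain ⟨n, hn⟩ := hq
    refine ⟨max m n, fun k hk => ?_⟩
    rw [map_add, map_add, hm k (le_of_max_le_left hk), hn k (le_of_max_le_right hk)]
  | mul_X p i hp =>
    obtain ⟨m, hm⟩ := hp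
    refine ⟨max m i, fun k hk => ?_⟩
    rw [map_mul, map_mul, hm k (le_of_max_le_left hk)]
    congr 1
    exact (truncateGens_tGen k i).trans
      (if_pos (Nat.lt_succ_of_le (le_of_max_le_right hk)))

/-- The finite sums of the universal sequence are automorphisms, and an element of the presentation
involves only finitely many generators, so that it is detected by the classifying map of such a
finite sum. -/
lemma injective_of_isFormalSum {f : SigmaPresentation →ₐ[ZMod 2] SigmaAlg}
    (hf : IsFormalSum (fun i => f (tGen i)) universalAut) : Function.Injective f := by
  rw [injective_iff_map_eq_zero]
  intro p hp
  obtain ⟨n, hn⟩ := exists_truncateGens_eq p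
  have hsum := isFormalSum_truncate tGen (n + 1)
  have haut : IsFormalAut (formalPartialSum tGen (n + 1)) := by
    apply (isFormalEnd_formalPartialSum tGen_pow_four (n + 1)).isFormalAut
    rw [hsum.coeff_one, if_pos n.succ_pos]
    exact IsUnit.of_pow_eq_one tGen_zero_pow_three three_ne_zero
  have hcomp : (classify _ haut).comp f = truncateGens n := by
    apply presentation_hom_ext
    intro i
    have h1 := hf.map (classify _ haut)
    rw [map_classify] at h1
    exact (h1.unique hsum i).trans (truncateGens_tGen n i).symm
  rw [← hn, ← hcomp, AlgHom.comp_apply, hp, map_zero]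

lemma surjective_of_isFormalSum {f : SigmaPresentation →ₐ[ZMod 2] SigmaAlg}
    (hf : IsFormalSum (fun i => f (tGen i)) universalAut) : Function.Surjective f := by
  have hcoeff (n : ℕ) : toSigma (MvPolynomial.X (some n)) ∈ f.range := by
    rw [← coeff_universalAut]
    have h1 := PowerSeries.X_pow_dvd_iff.mp (hf (n + 1)) (n + 1) (Nat.lt_two_pow_self)
    rw [map_sub, sub_eq_zero] at h1
    rw [h1, ← map_formalPartialSum f, PowerSeries.coeff_map]
    exact ⟨_, rfl⟩
  have h1 : f (tGen 0) = toSigma (MvPolynomial.X (some 0)) := by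
    rw [← coeff_universalAut, ← hf.coeff_one]
  have hinv : toSigma (MvPolynomial.X none) ∈ f.range := by
    have e : toSigma (MvPolynomial.X none) = f (tGen 0 ^ 2) := by
      have h2 := toSigma_unit
      rw [← h1] at h2
      have h3 : f (tGen 0 ^ 2) * f (tGen 0) = 1 := by
        rw [← map_mul, ← pow_succ, tGen_zero_pow_three, map_one]
      exact (left_inv_eq_right_inv h3 h2).symm
    rw [e]
    exact ⟨_, rfl⟩
  intro x
  obtain ⟨p, rfl⟩ := Ideal.Quotient.mk_surjective x
  change toSigma p ∈ f.range
  induction p using MvPolynomial.induction_on with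
  | C a => exact f.range.algebraMap_mem a
  | add p q hp hq =>
    rw [map_add]
    exact add_mem hp hq
  | mul_X p i hp =>
    rw [map_mul]
    refine mul_mem hp ?_
    cases i with
    | none => exact hinv
    | some n => exact hcoeff n

theorem exists_presentation_equiv : ∃ e : SigmaPresentation ≃ₐ[ZMod 2] SigmaAlg,
    IsFormalSum (fun i => e (tGen i)) universalAut := by
  obtain ⟨t, ht, hsum⟩ := isFormalAut_universalAut.isFormalEnd.exists_isFormalSum
  have hu : IsUnit (t 0) := by
    rw [← hsum.coeff_one]
    exact isFormalAut_universalAut.2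
  have h3 : t 0 ^ 3 = 1 := by
    apply hu.mul_right_cancel
    rw [← pow_succ, ht, one_mul]
  set f := presentationLift t h3 fun i => ht (i + 1) with hf
  have hft : (fun i => f (tGen i)) = t := funext fun i => presentationLift_tGen _ _ _ i
  have hsum' : IsFormalSum (fun i => f (tGen i)) universalAut := by rwa [hft]
  exact ⟨AlgEquiv.ofBijective f ⟨injective_of_isFormalSum hsum', surjective_of_isFormalSum hsum'⟩,
    hsum'⟩

end Presentation

/-! ### Coalgebra filtrations -/

section CoalgFiltration

variable {k : Type*} [Field k] {C : Type*} [AddCommGroup C] [Module k C]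

/-- The part of degree at most `n` of the tensor square of a filtered vector space. -/
def tensorFiltration (A : ℕ → Submodule k C) (n : ℕ) : Submodule k (C ⊗[k] C) :=
  Submodule.span k {y | ∃ i j, i + j ≤ n ∧ ∃ a ∈ A i, ∃ b ∈ A j, a ⊗ₜ[k] b = y}

lemma tmul_mem_tensorFiltration {A : ℕ → Submodule k C} {i j n : ℕ} (h : i + j ≤ n) {a b : C}
    (ha : a ∈ A i) (hb : b ∈ A j) : a ⊗ₜ[k] b ∈ tensorFiltration A n :=
  Submodule.subset_span ⟨i, j, h, a, ha, b, hb, rfl⟩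

lemma map_mulEquiv {B : Type*} [AddCommGroup B] [Module k B] (f : C →ₗ[k] B) (m n : ℕ)
    (z : TensorPower k m C ⊗[k] TensorPower k n C) :
    PiTensorProduct.map (R := k) (fun _ : Fin (m + n) => f) (TensorPower.mulEquiv z) =
      TensorPower.mulEquiv (TensorProduct.map
        (PiTensorProduct.map (R := k) (fun _ : Fin m => f))
        (PiTensorProduct.map (R := k) (fun _ : Fin n => f)) z) := by
  suffices h : PiTensorProduct.map (R := k) (fun _ : Fin (m + n) => f) ∘ₗ
      (TensorPower.mulEquiv (R := k) (M := C) (n := m) (m := n)).toLinearMap =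
      (TensorPower.mulEquiv (R := k) (M := B) (n := m) (m := n)).toLinearMap ∘ₗ
        TensorProduct.map (PiTensorProduct.map (R := k) (fun _ : Fin m => f))
        (PiTensorProduct.map (R := k) (fun _ : Fin n => f)) from DFunLike.congr_fun h z
  ext a b
  have h1 := TensorPower.tprod_mul_tprod k a b
  have h2 := TensorPower.tprod_mul_tprod k (fun i => f (a i)) (fun i => f (b i))
  rw [TensorPower.gMul_def] at h1 h2
  simp only [LinearMap.compMultilinearMap_apply, TensorProduct.AlgebraTensorModule.curry_apply,
    LinearMap.restrictScalars_self, TensorProduct.curry_apply, LinearMap.comp_apply,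
    LinearEquiv.coe_coe, TensorProduct.map_tmul, PiTensorProduct.map_tprod, h1, h2]
  congr 1
  funext i
  refine Fin.addCases (fun i => ?_) (fun i => ?_) i <;> simp

variable [Coalgebra k C]

/-- The operator `x ↦ ∑ f(x₁) x₂` given by a linear functional `f` on a coalgebra. -/
def leftAct (f : C →ₗ[k] k) : C →ₗ[k] C :=
  (TensorProduct.lid k C).toLinearMap ∘ₗ f.rTensor C ∘ₗ Coalgebra.comul

lemma leftAct_mem {D : Submodule k C} (hD : IsSubcoalgebra k D) (f : C →ₗ[k] k) {x : C}
    (hx : x ∈ D) : leftAct f x ∈ D := by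
  obtain ⟨z, hz⟩ := hD x hx
  simp only [leftAct, LinearMap.comp_apply, ← hz]
  clear hz
  induction z using TensorProduct.induction_on with
  | zero => simp
  | tmul a b => simpa using D.smul_mem _ b.2
  | add a b ha hb =>
    rw [map_add, map_add, map_add]
    exact add_mem ha hb

/-- A functional that agrees with the counit on a subcoalgebra acts as the identity. -/
lemma leftAct_eq_self {D : Submodule k C} (hD : IsSubcoalgebra k D) {f : C →ₗ[k] k}
    (hf : ∀ x ∈ D, f x = Coalgebra.counit x) {x : C} (hx : x ∈ D) : leftAct f x = x := by
  have h := Coalgebra.rTensor_counit_comul (R := k) x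
  obtain ⟨z, hz⟩ := hD x hx
  have e : f.rTensor C (TensorProduct.map D.subtype D.subtype z) =
      Coalgebra.counit.rTensor C (TensorProduct.map D.subtype D.subtype z) := by
    rw [LinearMap.rTensor, LinearMap.rTensor, ← LinearMap.comp_apply, ← LinearMap.comp_apply,
      ← TensorProduct.map_comp, ← TensorProduct.map_comp]
    congr 2
    ext y
    exact hf y y.2
  rw [leftAct, LinearMap.comp_apply, LinearMap.comp_apply, ← hz, e, hz, h]
  simp

lemma leftAct_of_isGroupLikeElem (f : C →ₗ[k] k) {g : C} (hg : IsGroupLikeElem k g) :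
    leftAct f g = f g • g := by
  simp [leftAct, hg.comul_eq_tmul_self]

lemma isSubcoalgebra_span_singleton {g : C} (hg : IsGroupLikeElem k g) :
    IsSubcoalgebra k (Submodule.span k {g}) := by
  intro x hx
  obtain ⟨c, rfl⟩ := Submodule.mem_span_singleton.mp hx
  rw [map_smul, hg.comul_eq_tmul_self]
  exact Submodule.smul_mem _ _ ⟨⟨g, Submodule.mem_span_singleton_self g⟩ ⊗ₜ
    ⟨g, Submodule.mem_span_singleton_self g⟩, rfl⟩

lemma isSimpleSubcoalgebra_span_singleton {g : C} (hg : IsGroupLikeElem k g) :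
    IsSimpleSubcoalgebra k (Submodule.span k {g}) := by
  have hg0 : g ≠ 0 := hg.ne_zero
  refine ⟨isSubcoalgebra_span_singleton hg, by simpa using hg0, fun D' _ hle => ?_⟩
  exact (nonzero_span_atom g hg0).le_iff.mp hle

/-- A nonzero subcoalgebra that meets the span of the grouplike elements contains a grouplike
element. -/
lemma exists_isGroupLikeElem_mem {D : Submodule k C} (hD : IsSubcoalgebra k D) {x : C}
    (hx : x ∈ D) (hx0 : x ≠ 0) (hxg : x ∈ Submodule.span k {g : C | IsGroupLikeElem k g}) :
    ∃ g ∈ D, IsGroupLikeElem k g := by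
  have hli : LinearIndependent k ((↑) : {g : C | IsGroupLikeElem k g} → C) :=
    linearIndepOn_isGroupLikeElem
  obtain ⟨c, hc⟩ := (Finsupp.mem_span_iff_linearCombination k _ x).mp hxg
  have hc0 : c ≠ 0 := by
    rintro rfl
    exact hx0 (by simpa using hc.symm)
  obtain ⟨g, hg⟩ := Finsupp.ne_iff.mp hc0
  -- the functional that is `1` on `g` and `0` on the other grouplike elements
  obtain ⟨f, hf⟩ := LinearMap.exists_extend (Finsupp.lapply g ∘ₗ hli.repr)
  have hfg (h : {g : C | IsGroupLikeElem k g}) : f h = (Finsupp.single h (1 : k)) g := by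
    have h1 := DFunLike.congr_fun hf ⟨h, Submodule.subset_span ⟨h, rfl⟩⟩
    rw [LinearMap.comp_apply, LinearMap.comp_apply,
      hli.repr_eq_single h _ rfl] at h1
    exact h1
  have hT : leftAct f x = c g • (g : C) := by
    rw [← hc, Finsupp.linearCombination_apply, Finsupp.sum, map_sum]
    rw [Finset.sum_eq_single g]
    · rw [map_smul, leftAct_of_isGroupLikeElem f g.2, hfg]
      simp
    · intro h _ hne
      rw [map_smul, leftAct_of_isGroupLikeElem f h.2, hfg, Finsupp.single_eq_of_ne hne.symm]
      simp
    · intro hn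
      rw [Finsupp.notMem_support_iff.mp hn]
      simp
  refine ⟨g, ?_, g.2⟩
  have h2 := leftAct_mem hD f hx
  rw [hT] at h2
  exact (D.smul_mem_iff hg).mp h2

variable (k) in
/-- An exhaustive coalgebra filtration whose degree zero part is spanned by grouplike elements. -/
structure IsPointedFiltration (A : ℕ → Submodule k C) : Prop where
  mono : Monotone A
  exhaustive : ∀ x, ∃ n, x ∈ A n
  comul_mem : ∀ n, ∀ x ∈ A n, Coalgebra.comul (R := k) x ∈ tensorFiltration A n
  zero_le : A 0 ≤ Submodule.span k {g : C | IsGroupLikeElem k g}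

variable {A : ℕ → Submodule k C}

/-- A functional that vanishes in degree zero lowers the degree. -/
lemma IsPointedFiltration.leftAct_mem (hA : IsPointedFiltration k A) {f : C →ₗ[k] k}
    (hf : ∀ x ∈ A 0, f x = 0) {n : ℕ} {x : C} (hx : x ∈ A (n + 1)) : leftAct f x ∈ A n := by
  have h : tensorFiltration A (n + 1) ≤
      (A n).comap ((TensorProduct.lid k C).toLinearMap ∘ₗ f.rTensor C) := by
    refine Submodule.span_le.mpr ?_
    rintro _ ⟨i, j, hij, a, ha, b, hb, rfl⟩
    simp only [Submodule.comap_coe, Set.mem_preimage, LinearMap.comp_apply,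
      LinearMap.rTensor_tmul, LinearEquiv.coe_coe, TensorProduct.lid_tmul, SetLike.mem_coe]
    cases i with
    | zero => simp [hf a ha]
    | succ i => exact (A n).smul_mem _ (hA.mono (by omega) hb)
  exact h (hA.comul_mem _ x hx)

/-- Every nonzero subcoalgebra meets the degree zero part. Otherwise there would be a functional
that agrees with the counit on the subcoalgebra and vanishes in degree zero. It would act as the
identity on the subcoalgebra, while lowering the degree. -/
lemma IsPointedFiltration.exists_mem_zero (hA : IsPointedFiltration k A) {D : Submodule k C}
    (hD : IsSubcoalgebra k D) (hD0 : D ≠ ⊥) : ∃ x ∈ D, x ∈ A 0 ∧ x ≠ 0 := by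
  by_contra! hcon
  have hker : LinearMap.ker ((A 0).mkQ ∘ₗ D.subtype) = ⊥ := by
    rw [LinearMap.ker_eq_bot']
    intro x hx
    have : (x : C) ∈ A 0 := by simpa using hx
    exact Subtype.ext (hcon x x.2 this)
  obtain ⟨r, hr⟩ := LinearMap.exists_leftInverse_of_injective _ hker
  have hid : ∀ n, ∀ x ∈ D, x ∈ A n → x = 0 := by
    intro n
    induction n with
    | zero => exact fun x hx hx0 => hcon x hx hx0
    | succ n ih =>
      intro x hx hxn
      refine ih x hx ?_
      have h1 : leftAct (Coalgebra.counit ∘ₗ D.subtype ∘ₗ r ∘ₗ (A 0).mkQ) x = x := by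
        refine leftAct_eq_self hD (fun y hy => ?_) hx
        have := DFunLike.congr_fun hr ⟨y, hy⟩
        simp only [LinearMap.comp_apply, Submodule.subtype_apply, LinearMap.id_apply] at this ⊢
        rw [this]
      rw [← h1]
      refine hA.leftAct_mem (fun y hy => ?_) hxn
      have : (A 0).mkQ y = 0 := by simpa using hy
      simp [LinearMap.comp_apply, this]
  refine hD0 (le_bot_iff.mp fun x hx => ?_)
  obtain ⟨n, hn⟩ := hA.exhaustive x
  exact (Submodule.mem_bot k).mpr (hid n x hx hn)

lemma IsPointedFiltration.exists_eq_span (hA : IsPointedFiltration k A) {D : Submodule k C}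
    (hD : IsSimpleSubcoalgebra k D) : ∃ g, IsGroupLikeElem k g ∧ Submodule.span k {g} = D := by
  obtain ⟨x, hxD, hxA, hx0⟩ := hA.exists_mem_zero hD.1 hD.2.1
  obtain ⟨g, hgD, hg⟩ := exists_isGroupLikeElem_mem hD.1 hxD hx0 (hA.zero_le hxA)
  refine ⟨g, hg, (hD.2.2 _ (isSubcoalgebra_span_singleton hg) ?_).resolve_left ?_⟩
  · simpa using hgD
  · simpa using (hg.ne_zero : g ≠ 0)

theorem IsPointedFiltration.isPointed (hA : IsPointedFiltration k A) : IsPointed k C := by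
  intro D hD
  obtain ⟨g, hg, rfl⟩ := hA.exists_eq_span hD
  exact finrank_span_singleton hg.ne_zero

/-- All grouplike elements have degree zero. -/
lemma IsPointedFiltration.mem_zero_of_isGroupLikeElem (hA : IsPointedFiltration k A) {g : C}
    (hg : IsGroupLikeElem k g) : g ∈ A 0 := by
  obtain ⟨x, hx, hxA, hx0⟩ := hA.exists_mem_zero (isSubcoalgebra_span_singleton hg)
    (by simpa using (hg.ne_zero : g ≠ 0))
  obtain ⟨c, rfl⟩ := Submodule.mem_span_singleton.mp hx
  exact ((A 0).smul_mem_iff fun h => hx0 (by rw [h, zero_smul])).mp hxA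

lemma IsPointedFiltration.zero_le_coradical (hA : IsPointedFiltration k A) :
    A 0 ≤ coradical k C := by
  refine hA.zero_le.trans (Submodule.span_le.mpr fun g hg => ?_)
  exact (le_sSup (isSimpleSubcoalgebra_span_singleton hg) :
    Submodule.span k {g} ≤ coradical k C) (Submodule.mem_span_singleton_self g)

/-- The filtration is finer than the coradical filtration: each term of an iterated coproduct with
`n + 1` factors of total degree at most `n` has a factor of degree zero. -/
lemma IsPointedFiltration.le_coradicalFiltration (hA : IsPointedFiltration k A) (n : ℕ) :
    A n ≤ coradicalFiltration k C n := by
  have hone {x : C} (hx : x ∈ A 0) : PiTensorProduct.map (R := k)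
      (fun _ : Fin 1 => (coradical k C).mkQ)
      ((PiTensorProduct.subsingletonEquiv (R := k) (s := fun _ : Fin 1 => C) 0).symm x) = 0 := by
    have h0 : (coradical k C).mkQ x = 0 := by simpa using hA.zero_le_coradical hx
    rw [PiTensorProduct.subsingletonEquiv_symm_apply', PiTensorProduct.map_tprod]
    exact MultilinearMap.map_coord_zero _ 0 h0
  induction n with
  | zero => exact fun x hx => hone hx
  | succ n ih =>
    intro x hx
    have h : tensorFiltration A (n + 1) ≤ LinearMap.ker
        (PiTensorProduct.map (R := k) (fun _ : Fin (n + 1 + 1) => (coradical k C).mkQ) ∘ₗ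
          (TensorPower.mulEquiv (R := k) (M := C) (n := n + 1) (m := 1)).toLinearMap ∘ₗ
          TensorProduct.map (iteratedComul k C n)
            (PiTensorProduct.subsingletonEquiv (R := k)
              (s := fun _ : Fin 1 => C) 0).symm.toLinearMap) := by
      refine Submodule.span_le.mpr ?_
      rintro _ ⟨i, j, hij, a, ha, b, hb, rfl⟩
      rw [SetLike.mem_coe, LinearMap.mem_ker, LinearMap.comp_apply, LinearMap.comp_apply,
        TensorProduct.map_tmul, LinearEquiv.coe_coe, map_mulEquiv, TensorProduct.map_tmul]
      rcases Nat.lt_or_ge n i with hi | hi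
      · obtain rfl : j = 0 := by omega
        rw [LinearEquiv.coe_coe, hone hb, TensorProduct.tmul_zero, map_zero]
      · have h1 : PiTensorProduct.map (R := k) (fun _ : Fin (n + 1) => (coradical k C).mkQ)
            (iteratedComul k C n a) = 0 := ih (hA.mono hi ha)
        rw [h1, TensorProduct.zero_tmul, map_zero]
    exact h (hA.comul_mem _ x hx)

theorem IsPointedFiltration.hasExhaustiveCoradicalFiltration (hA : IsPointedFiltration k A) :
    HasExhaustiveCoradicalFiltration k C := fun x =>
  (hA.exhaustive x).imp fun n hn => hA.le_coradicalFiltration n hn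

end CoalgFiltration

/-! ### The degree filtration of `Σ` -/

section SigmaFiltration

/-- The coefficient of `z^(n+1)` in the universal automorphism. -/
def univCoeff (n : ℕ) : SigmaAlg := toSigma (MvPolynomial.X (some n))

lemma coeff_succ_universalAut (n : ℕ) :
    PowerSeries.coeff (n + 1) universalAut = univCoeff n := coeff_universalAut n

/-- The filtration of `Σ` for which the coefficient of `z^(n+1)` in the universal automorphism has
degree `n`. -/
def degreeFiltration (n : ℕ) : Submodule (ZMod 2) SigmaAlg :=
  Submodule.span (ZMod 2) {x | ∃ m : ℕ →₀ ℕ, Finsupp.weight (id : ℕ → ℕ) m ≤ n ∧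
    (m.prod fun i e => univCoeff i ^ e) = x}

lemma degreeFiltration_mono : Monotone degreeFiltration := fun _ _ h =>
  Submodule.span_mono fun _ ⟨m, hm, hx⟩ => ⟨m, hm.trans h, hx⟩

lemma mul_mem_degreeFiltration {i j n : ℕ} (h : i + j ≤ n) {a b : SigmaAlg}
    (ha : a ∈ degreeFiltration i) (hb : b ∈ degreeFiltration j) :
    a * b ∈ degreeFiltration n := by
  have h1 := Submodule.mul_mem_mul ha hb
  rw [degreeFiltration, degreeFiltration, Submodule.span_mul_span] at h1
  refine Submodule.span_mono ?_ h1
  rintro _ ⟨_, ⟨m, hm, rfl⟩, _, ⟨m', hm', rfl⟩, rfl⟩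
  refine ⟨m + m', by rw [map_add]; omega, ?_⟩
  exact Finsupp.prod_add_index' (fun _ => pow_zero _) fun _ _ _ => pow_add _ _ _

lemma one_mem_degreeFiltration (n : ℕ) : (1 : SigmaAlg) ∈ degreeFiltration n :=
  Submodule.subset_span ⟨0, by simp, Finsupp.prod_zero_index⟩

lemma univCoeff_mem_degreeFiltration (n : ℕ) : univCoeff n ∈ degreeFiltration n :=
  Submodule.subset_span ⟨Finsupp.single n 1, by rw [Finsupp.weight_single]; simp, by simp⟩

lemma univCoeff_zero_pow_three : univCoeff 0 ^ 3 = 1 := by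
  have h := isFormalAut_universalAut.isFormalEnd.coeff_one_pow_four
  have hu := isFormalAut_universalAut.isUnit_coeff_one
  rw [show (1 : ℕ) = 0 + 1 from rfl, coeff_succ_universalAut] at h hu
  apply hu.mul_right_cancel
  rw [← pow_succ, h, one_mul]

lemma toSigma_X_none : toSigma (MvPolynomial.X none) = univCoeff 0 * univCoeff 0 := by
  have h2 : univCoeff 0 * toSigma (MvPolynomial.X none) = 1 := toSigma_unit
  have h3 : univCoeff 0 * univCoeff 0 * univCoeff 0 = 1 := by
    rw [← pow_two, ← pow_succ, univCoeff_zero_pow_three]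
  exact (left_inv_eq_right_inv h3 h2).symm

lemma degreeFiltration_exhaustive (x : SigmaAlg) : ∃ n, x ∈ degreeFiltration n := by
  obtain ⟨p, rfl⟩ := Ideal.Quotient.mk_surjective x
  change ∃ n, toSigma p ∈ degreeFiltration n
  induction p using MvPolynomial.induction_on with
  | C a =>
    refine ⟨0, ?_⟩
    have h : toSigma (MvPolynomial.C a) = a • (1 : SigmaAlg) :=
      (toSigma.commutes a).trans (Algebra.algebraMap_eq_smul_one a)
    rw [h]
    exact (degreeFiltration 0).smul_mem a (one_mem_degreeFiltration 0)
  | add p q hp hq =>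
    obtain ⟨m, hm⟩ := hp
    obtain ⟨n, hn⟩ := hq
    rw [map_add]
    exact ⟨max m n, add_mem (degreeFiltration_mono (le_max_left _ _) hm)
      (degreeFiltration_mono (le_max_right _ _) hn)⟩
  | mul_X p i hp =>
    obtain ⟨m, hm⟩ := hp
    have hi : ∃ n, toSigma (MvPolynomial.X i) ∈ degreeFiltration n := by
      cases i with
      | some n => exact ⟨n, univCoeff_mem_degreeFiltration n⟩
      | none =>
        have h0 := univCoeff_mem_degreeFiltration 0
        refine ⟨0, ?_⟩
        rw [toSigma_X_none]
        exact mul_mem_degreeFiltration (i := 0) (j := 0) le_rfl h0 h0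
    obtain ⟨n, hn⟩ := hi
    rw [map_mul]
    exact ⟨m + n, mul_mem_degreeFiltration le_rfl hm hn⟩

/-- The coefficient of `z^(d+j)` in the `d`-th power of the universal automorphism has
degree `j`. -/
lemma coeff_universalAut_pow_mem (d j : ℕ) :
    PowerSeries.coeff (d + j) (universalAut ^ d) ∈ degreeFiltration j := by
  obtain ⟨q, hq⟩ := PowerSeries.X_dvd_iff.mpr isFormalAut_universalAut.1
  have hqc (j : ℕ) : PowerSeries.coeff j q = univCoeff j := by
    rw [← coeff_succ_universalAut, hq, PowerSeries.coeff_succ_X_mul]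
  rw [hq, mul_pow, add_comm, PowerSeries.coeff_X_pow_mul]
  induction d generalizing j with
  | zero =>
    rw [pow_zero, PowerSeries.coeff_one]
    split_ifs
    · exact one_mem_degreeFiltration j
    · exact zero_mem _
  | succ d ih =>
    rw [pow_succ, PowerSeries.coeff_mul]
    refine sum_mem fun p hp => ?_
    rw [Finset.HasAntidiagonal.mem_antidiagonal] at hp
    refine mul_mem_degreeFiltration hp.le (ih _) ?_
    rw [hqc]
    exact univCoeff_mem_degreeFiltration _

lemma mul_mem_tensorFiltration {i j n : ℕ} (h : i + j ≤ n) {a b : SigmaAlg ⊗[ZMod 2] SigmaAlg}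
    (ha : a ∈ tensorFiltration degreeFiltration i)
    (hb : b ∈ tensorFiltration degreeFiltration j) :
    a * b ∈ tensorFiltration degreeFiltration n := by
  have h1 := Submodule.mul_mem_mul ha hb
  rw [tensorFiltration, tensorFiltration, Submodule.span_mul_span] at h1
  refine Submodule.span_mono ?_ h1
  rintro _ ⟨_, ⟨i₁, i₂, hi, a₁, ha₁, a₂, ha₂, rfl⟩, _, ⟨j₁, j₂, hj, b₁, hb₁, b₂, hb₂, rfl⟩, rfl⟩
  exact ⟨i₁ + j₁, i₂ + j₂, by omega, a₁ * b₁, mul_mem_degreeFiltration le_rfl ha₁ hb₁, a₂ * b₂,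
    mul_mem_degreeFiltration le_rfl ha₂ hb₂, (Algebra.TensorProduct.tmul_mul_tmul _ _ _ _).symm⟩

lemma one_mem_tensorFiltration (n : ℕ) :
    (1 : SigmaAlg ⊗[ZMod 2] SigmaAlg) ∈ tensorFiltration degreeFiltration n :=
  tmul_mem_tensorFiltration (Nat.zero_le n) (one_mem_degreeFiltration 0)
    (one_mem_degreeFiltration 0)

lemma comul_univCoeff (n : ℕ) :
    sigmaComul (univCoeff n) = PowerSeries.coeff (n + 1) (leftAut.subst rightAut) := by
  have h : PowerSeries.map (sigmaComul : SigmaAlg →+* SigmaAlg ⊗[ZMod 2] SigmaAlg) universalAut =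
      leftAut.subst rightAut := map_classify _ _
  rw [← h, PowerSeries.coeff_map, coeff_succ_universalAut]
  rfl

/-- The coproduct of the coefficient of `z^(n+1)` is the sum over `d` of
`a_d ⊗ [z^(n+1)] g(z)^d`, where the two factors have degrees `d - 1` and `n + 1 - d`. -/
lemma comul_univCoeff_mem (n : ℕ) :
    sigmaComul (univCoeff n) ∈ tensorFiltration degreeFiltration n := by
  rw [comul_univCoeff, PowerSeries.coeff_subst' (hasSubst_of_zero isFormalAut_rightAut.1)]
  refine finsum_induction (· ∈ tensorFiltration degreeFiltration n) (zero_mem _)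
    (fun _ _ => add_mem) fun d => ?_
  rw [rightAut, ← map_pow, PowerSeries.coeff_map, leftAut, PowerSeries.coeff_map, smul_eq_mul]
  change (PowerSeries.coeff d universalAut ⊗ₜ[ZMod 2] (1 : SigmaAlg)) *
    ((1 : SigmaAlg) ⊗ₜ[ZMod 2] PowerSeries.coeff (n + 1) (universalAut ^ d)) ∈ _
  rw [Algebra.TensorProduct.tmul_mul_tmul, mul_one, one_mul]
  cases d with
  | zero =>
    rw [PowerSeries.coeff_zero_eq_constantCoeff_apply, isFormalAut_universalAut.1,
      TensorProduct.zero_tmul]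
    exact zero_mem _
  | succ d =>
    rw [coeff_succ_universalAut]
    rcases Nat.lt_or_ge n d with hlt | hle
    · have h0 : PowerSeries.coeff (n + 1) (universalAut ^ (d + 1)) = 0 := by
        refine PowerSeries.X_pow_dvd_iff.mp (pow_dvd_pow_of_dvd
          (PowerSeries.X_dvd_iff.mpr isFormalAut_universalAut.1) (d + 1)) _ (by omega)
      rw [h0, TensorProduct.tmul_zero]
      exact zero_mem _
    · have h1 := coeff_universalAut_pow_mem (d + 1) (n - d)
      rw [show d + 1 + (n - d) = n + 1 by omega] at h1
      exact tmul_mem_tensorFiltration (by omega) (univCoeff_mem_degreeFiltration d) h1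

lemma comul_mem_tensorFiltration (n : ℕ) (x : SigmaAlg) (hx : x ∈ degreeFiltration n) :
    sigmaComul x ∈ tensorFiltration degreeFiltration n := by
  have hpow (i e : ℕ) :
      sigmaComul (univCoeff i) ^ e ∈ tensorFiltration degreeFiltration (e * i) := by
    induction e with
    | zero => exact one_mem_tensorFiltration _
    | succ e ih =>
      rw [pow_succ]
      exact mul_mem_tensorFiltration (Nat.succ_mul e i).ge ih (comul_univCoeff_mem i)
  have hmon (m : ℕ →₀ ℕ) : sigmaComul (m.prod fun i e => univCoeff i ^ e) ∈
      tensorFiltration degreeFiltration (Finsupp.weight (id : ℕ → ℕ) m) := by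
    induction m using Finsupp.induction_linear with
    | zero =>
      rw [Finsupp.prod_zero_index, map_one]
      exact one_mem_tensorFiltration _
    | add m m' hm hm' =>
      rw [Finsupp.prod_add_index' (fun _ => pow_zero _) fun _ _ _ => pow_add _ _ _, map_mul,
        map_add]
      exact mul_mem_tensorFiltration le_rfl hm hm'
    | single i e =>
      rw [Finsupp.prod_single_index (h := fun i e => univCoeff i ^ e) (pow_zero _), map_pow, Finsupp.weight_single]
      exact hpow i e
  have hmono {i j : ℕ} (h : i ≤ j) :
      tensorFiltration degreeFiltration i ≤ tensorFiltration degreeFiltration j :=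
    Submodule.span_mono fun _ ⟨i₁, i₂, hi, H⟩ => ⟨i₁, i₂, hi.trans h, H⟩
  suffices H : degreeFiltration n ≤
      (tensorFiltration degreeFiltration n).comap sigmaComul.toLinearMap from H hx
  refine Submodule.span_le.mpr ?_
  rintro _ ⟨m, hm, rfl⟩
  exact hmono hm (hmon m)

lemma isGroupLikeElem_univCoeff_zero : IsGroupLikeElem (ZMod 2) (univCoeff 0) where
  counit_eq_one := by
    have h : PowerSeries.map (sigmaCounit : SigmaAlg →+* ZMod 2) universalAut = PowerSeries.X :=
      map_classify _ _
    have h1 := congrArg (PowerSeries.coeff 1) h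
    rw [PowerSeries.coeff_map, show (1 : ℕ) = 0 + 1 from rfl, coeff_succ_universalAut, zero_add,
      PowerSeries.coeff_one_X] at h1
    exact h1
  comul_eq_tmul_self := by
    change sigmaComul (univCoeff 0) = _
    rw [comul_univCoeff, zero_add, coeff_one_comp isFormalAut_rightAut.1, leftAut, rightAut,
      PowerSeries.coeff_map, PowerSeries.coeff_map, show (1 : ℕ) = 0 + 1 from rfl,
      coeff_succ_universalAut]
    exact (Algebra.TensorProduct.tmul_mul_tmul _ _ _ _).trans (by rw [mul_one, one_mul])

lemma degreeFiltration_zero_le :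
    degreeFiltration 0 ≤ Submodule.span (ZMod 2) {1, univCoeff 0, univCoeff 0 ^ 2} := by
  refine Submodule.span_mono ?_
  rintro _ ⟨m, hm, rfl⟩
  have hm0 : m = Finsupp.single 0 (m 0) := by
    ext i
    rcases eq_or_ne i 0 with rfl | hi
    · simp
    · rw [Finsupp.single_eq_of_ne hi]
      by_contra hmi
      have := Finsupp.le_weight (id : ℕ → ℕ) hi m
      omega
  rw [hm0, Finsupp.prod_single_index (h := fun i e => univCoeff i ^ e) (pow_zero _), ← Nat.div_add_mod (m 0) 3, pow_add, pow_mul,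
    univCoeff_zero_pow_three, one_pow, one_mul]
  have h3 := Nat.mod_lt (m 0) three_pos
  interval_cases m 0 % 3 <;> simp

lemma isPointedFiltration_degreeFiltration :
    IsPointedFiltration (ZMod 2) degreeFiltration where
  mono := degreeFiltration_mono
  exhaustive := degreeFiltration_exhaustive
  comul_mem := comul_mem_tensorFiltration
  zero_le := degreeFiltration_zero_le.trans (Submodule.span_mono (by
    rintro _ (rfl | rfl | rfl)
    · exact IsGroupLikeElem.one
    · exact isGroupLikeElem_univCoeff_zero
    · exact isGroupLikeElem_univCoeff_zero.pow))

lemma setOf_isGroupLikeElem : {a : SigmaAlg | IsGroupLikeElem (ZMod 2) a} =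
    {1, univCoeff 0, univCoeff 0 ^ 2} := by
  have hsub : ({1, univCoeff 0, univCoeff 0 ^ 2} : Set SigmaAlg) ⊆
      {a : SigmaAlg | IsGroupLikeElem (ZMod 2) a} := by
    rintro _ (rfl | rfl | rfl)
    · exact IsGroupLikeElem.one
    · exact isGroupLikeElem_univCoeff_zero
    · exact isGroupLikeElem_univCoeff_zero.pow
  refine Set.Subset.antisymm (fun x hx => ?_) hsub
  by_contra hxS
  have hli : LinearIndepOn (ZMod 2) id (insert x {1, univCoeff 0, univCoeff 0 ^ 2}) :=
    linearIndepOn_isGroupLikeElem.mono (Set.insert_subset hx hsub)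
  have h1 := hli.notMem_span_of_insert hxS
  rw [Set.image_id] at h1
  exact h1 (degreeFiltration_zero_le
    (isPointedFiltration_degreeFiltration.mem_zero_of_isGroupLikeElem hx))

end SigmaFiltration

end MoravaHopf

end

theorem lemma3p2 :
    (∃ e : SigmaPresentation ≃ₐ[ZMod 2] SigmaAlg,
      IsFormalSum (fun i => e (tGen i)) universalAut ∧
      {a : SigmaAlg | IsGroupLikeElem (ZMod 2) a} = {1, e (tGen 0), e (tGen 0) ^ 2}) ∧
    IsPointed (ZMod 2) SigmaAlg ∧
    HasExhaustiveCoradicalFiltration (ZMod 2) SigmaAlg := by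
  obtain ⟨e, he⟩ := exists_presentation_equiv
  have h0 : e (tGen 0) = univCoeff 0 := by
    rw [← coeff_succ_universalAut, zero_add, he.coeff_one]
  refine ⟨⟨e, he, ?_⟩, isPointedFiltration_degreeFiltration.isPointed,
    isPointedFiltration_degreeFiltration.hasExhaustiveCoradicalFiltration⟩
  rw [h0]
  exact setOf_isGroupLikeElem
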